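/- Let $n\ge 2$ and let $\Lambda^p(\mathbb R^{2n})$ be the space of germs at $0$ of $C^\infty$ differential $p$-forms on $\mathbb R^{2n}$ (coordinates $x_1,\dots,x_{2n}$). Let $$W_9=\{x\in\mathbb R^{2n} : x_1^2+x_2x_3^2=x_2^2+x_1x_3=0,\ x_4=\dots=x_{2n}=0\}.$$ Two germs $\omega,\tilde\omega\in\Lambda^2(\mathbb R^{2n})$ have the same algebraic restriction to $W_9$, written $[\omega]_{W_9}=[\tilde\omega]_{W_9}$, if $\omega-\tilde\omega=\alpha+d\beta$, where $\alpha\in\Lambda^2(\mathbb R^{2n})$ and $\beta\in\Lambda^1(\mathbb R^{2n})$ vanish at every point of (the germ at $0$ of) $W_9$. Denote by $[Z^2(\mathbb R^{2n})]_{W_9}$ the vector space of algebraic restrictions to $W_9$ of germs of closed $2$-forms, and by $[\mathrm{Symp}(\mathbb R^{2n})]_{W_9}$ the subset of algebraic restrictions of germs of symplectic (closed nondegenerate) $2$-forms. Consider the closed $2$-forms $$\theta_1=dx_2\wedge dx_3,\quad \theta_2=dx_1\wedge dx_3,\quad \theta_3=dx_1\wedge dx_2,\quad \theta_4=x_3\,dx_2\wedge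 dx_3,\quad \theta_5=x_3\,dx_1\wedge dx_3,$$ $$\theta_6=x_1\,dx_2\wedge dx_3+x_2\,dx_1\wedge dx_3,\quad \theta_7=x_3^2\,dx_2\wedge dx_3,\quad \theta_8=x_3^2\,dx_1\wedge dx_3,\quad \theta_9=x_3^3\,dx_2\wedge dx_3,$$ which, for any positive weights $w_1,\dots,w_{2n}$ of the coordinates with $(w_1,w_2,w_3)=(5,4,3)$, are quasi-homogeneous of degrees $7,8,9,10,11,12,13,14,16$ respectively (a form $\omega$ is quasi-homogeneous of degree $\delta$ if $F_t^*\omega=t^\delta\omega$ for all $t>0$, where $F_t(x)=(t^{w_1}x_1,\dots,t^{w_{2n}}x_{2n})$). Then $[Z^2(\mathbb R^{2n})]_{W_9}$ is a $9$-dimensional real vector space with basis $[\theta_1]_{W_9},\dots,[\theta_9]_{W_9}$. If $n\ge 3$, then $[\mathrm{Symp}(\mathbb R^{2n})]_{W_9}=[Z^2(\mathbb R^{2n})]_{W_9}$. If $n=2$, then $[\mathrm{Symp}(\mathbb R^{4})]_{W_9}$ is the open part of the $9$-dimensional space $[Z^2(\mathbb R^4)]_{W_9}$ consisting of the algebraic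 restrictions $[c_1\theta_1+\dots+c_9\theta_9]_{W_9}$ with $(c_1,c_2,c_3)\ne(0,0,0)$. -/

import Mathlib

open Filter Topology

noncomputable section

namespace AlgRestr

/-! ### Germs at `0` of differential forms on `ℝ^m` -/

/-- The space `ℝ^m`. -/
abbrev E (m : ℕ) : Type := Fin m → ℝ

/-- A (not necessarily smooth) differential `p`-form on `ℝ^m`. -/
abbrev Form (m p : ℕ) : Type := E m → (E m) [⋀^Fin p]→L[ℝ] ℝ

/-- Germs at `0` of arbitrary (not necessarily smooth) `p`-forms on `ℝ^m`. -/
def FormGerm (m p : ℕ) : Type := Germ (𝓝 (0 : E m)) ((E m) [⋀^Fin p]→L[ℝ] ℝ)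

instance (m p : ℕ) : AddCommGroup (FormGerm m p) :=
  inferInstanceAs (AddCommGroup (Germ (𝓝 (0 : E m)) ((E m) [⋀^Fin p]→L[ℝ] ℝ)))

instance (m p : ℕ) : Module ℝ (FormGerm m p) :=
  inferInstanceAs (Module ℝ (Germ (𝓝 (0 : E m)) ((E m) [⋀^Fin p]→L[ℝ] ℝ)))

/-- The germ at `0` of a form. -/
def toGerm (m p : ℕ) : Form m p →ₗ[ℝ] FormGerm m p where
  toFun ω := Germ.ofFun ω
  map_add' _ _ := rfl
  map_smul' _ _ := rfl

theorem toGerm_eq {m p : ℕ} {ω η : Form m p} :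
    toGerm m p ω = toGerm m p η ↔ ω =ᶠ[𝓝 0] η := Germ.coe_eq

/-- `ω` is `C^∞` on some neighbourhood of `0`. -/
def SmoothNearZero {m p : ℕ} (ω : Form m p) : Prop :=
  ∀ᶠ x in 𝓝 (0 : E m), ContDiffAt ℝ ((⊤ : ℕ∞) : WithTop ℕ∞) ω x

theorem SmoothNearZero.add {m p : ℕ} {ω η : Form m p} (h : SmoothNearZero ω)
    (h' : SmoothNearZero η) : SmoothNearZero (ω + η) := by
  filter_upwards [h, h'] with x hx hx' using hx.add hx'

theorem SmoothNearZero.smul {m p : ℕ} {ω : Form m p} (c : ℝ) (h : SmoothNearZero ω) :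
    SmoothNearZero (c • ω) := by
  filter_upwards [h] with x hx using contDiffAt_const.smul hx

theorem SmoothNearZero.extDeriv {m p : ℕ} {ω : Form m p} (h : SmoothNearZero ω) :
    SmoothNearZero (_root_.extDeriv ω) := by
  filter_upwards [h] with x hx
  have h1 : ContDiffAt ℝ ((⊤ : ℕ∞) : WithTop ℕ∞) (fderiv ℝ ω) x := hx.fderiv_right (by simp)
  exact (ContinuousAlternatingMap.alternatizeUncurryFinCLM ℝ (E m) ℝ
    (n := p)).contDiff.contDiffAt.comp x h1

/-- `Λ^p(ℝ^m)`: the space of germs at `0` of smooth `p`-forms on `ℝ^m`. -/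
def Lam (m p : ℕ) : Submodule ℝ (FormGerm m p) where
  carrier := {g | ∃ ω : Form m p, SmoothNearZero ω ∧ toGerm m p ω = g}
  add_mem' := by
    rintro _ _ ⟨ω, hω, rfl⟩ ⟨η, hη, rfl⟩
    exact ⟨ω + η, hω.add hη, map_add _ ω η⟩
  zero_mem' := ⟨0, Eventually.of_forall fun _ => contDiffAt_const, map_zero _⟩
  smul_mem' := by
    rintro c _ ⟨ω, hω, rfl⟩
    exact ⟨c • ω, hω.smul c, map_smul _ c ω⟩

/-- The germ at `0` of a form that is smooth near `0`, as an element of `Λ^p(ℝ^m)`. -/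
def germ {m p : ℕ} (ω : Form m p) (h : SmoothNearZero ω) : Lam m p :=
  ⟨toGerm m p ω, ω, h, rfl⟩

/-- The exterior derivative of a germ. -/
def dGerm {m p : ℕ} (g : FormGerm m p) : FormGerm m (p + 1) :=
  Germ.map' _root_.extDeriv (fun _ _ h => Filter.EventuallyEq.extDeriv h) g

/-- The exterior derivative `d : Λ^p(ℝ^m) → Λ^{p+1}(ℝ^m)`. -/
def d (m p : ℕ) : Lam m p →ₗ[ℝ] Lam m (p + 1) where
  toFun g := ⟨dGerm g.1, by
    obtain ⟨_, ω, hω, rfl⟩ := g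
    exact ⟨_root_.extDeriv ω, hω.extDeriv, rfl⟩⟩
  map_add' := by
    rintro ⟨_, ω, hω, rfl⟩ ⟨_, η, hη, rfl⟩
    refine Subtype.ext (toGerm_eq.2 ?_)
    filter_upwards [hω, hη] with x hx hx'
    exact extDeriv_add (hx.differentiableAt (by simp)) (hx'.differentiableAt (by simp))
  map_smul' := by
    rintro c ⟨_, ω, hω, rfl⟩
    refine Subtype.ext (toGerm_eq.2 ?_)
    exact Eventually.of_forall fun x => extDeriv_smul c ω

theorem d_germ {m p : ℕ} (ω : Form m p) (h : SmoothNearZero ω) :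
    d m p (germ ω h) = germ (_root_.extDeriv ω) h.extDeriv := rfl

/-! ### Algebraic restrictions -/

/-- `Λ^p_N(ℝ^m)`: germs of smooth `p`-forms `ω` with `ω(x) = 0` (as a form on the whole of
`T_x ℝ^m`) at every point `x` of the germ at `0` of `N`. -/
def LamVanish {m : ℕ} (N : Set (E m)) (p : ℕ) : Submodule ℝ (Lam m p) where
  carrier := {g | ∃ ω : Form m p, toGerm m p ω = g.1 ∧
    ∀ᶠ x in 𝓝 (0 : E m), x ∈ N → ω x = 0}
  add_mem' := by
    rintro g g' ⟨ω, hω, h⟩ ⟨η, hη, h'⟩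
    refine ⟨ω + η, ?_, ?_⟩
    · rw [map_add, hω, hη]; rfl
    · filter_upwards [h, h'] with x hx hx' hN
      simp [hx hN, hx' hN]
  zero_mem' := ⟨0, map_zero _, Eventually.of_forall fun _ _ => rfl⟩
  smul_mem' := by
    rintro c g ⟨ω, hω, h⟩
    refine ⟨c • ω, ?_, ?_⟩
    · rw [map_smul, hω]; rfl
    · filter_upwards [h] with x hx hN
      simp [hx hN]

/-- `𝒜_0^2(N, ℝ^m) = {α + dβ : α ∈ Λ^2_N(ℝ^m), β ∈ Λ^1_N(ℝ^m)}`. -/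
def A0 {m : ℕ} (N : Set (E m)) : Submodule ℝ (Lam m 2) :=
  LamVanish N 2 ⊔ (LamVanish N 1).map (d m 1)

/-- `[Λ^2(ℝ^m)]_N`: the space of algebraic restrictions to `N` of germs of `2`-forms. -/
abbrev Restr {m : ℕ} (N : Set (E m)) : Type := Lam m 2 ⧸ A0 N

/-- `ω ↦ [ω]_N`. -/
def restr {m : ℕ} (N : Set (E m)) : Lam m 2 →ₗ[ℝ] Restr N := (A0 N).mkQ

/-- Germs of closed `2`-forms. -/
def Closed (m : ℕ) : Submodule ℝ (Lam m 2) := LinearMap.ker (d m 2)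

/-- `[Z^2(ℝ^m)]_N`: the algebraic restrictions to `N` of germs of closed `2`-forms. -/
def closedRestr {m : ℕ} (N : Set (E m)) : Submodule ℝ (Restr N) := (Closed m).map (restr N)

/-- Nondegeneracy of an alternating bilinear form. -/
def Nondeg {m : ℕ} (ω : (E m) [⋀^Fin 2]→L[ℝ] ℝ) : Prop :=
  ∀ v : E m, (∀ w : E m, ω ![v, w] = 0) → v = 0

/-- Germs of symplectic forms: closed and nondegenerate at every point near `0`. -/
def Symplectic (m : ℕ) : Set (Lam m 2) :=
  {g | g ∈ Closed m ∧ Germ.LiftPred Nondeg g.1}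

/-- `[Symp(ℝ^m)]_N`: the algebraic restrictions to `N` of germs of symplectic forms. -/
def sympRestr {m : ℕ} (N : Set (E m)) : Set (Restr N) := restr N '' Symplectic m

/-! ### Quasi-homogeneous forms -/

/-- The quasi-homogeneous dilation `x ↦ (t^{w_1} x_1, …, t^{w_m} x_m)`. -/
def dilation {m : ℕ} (w : Fin m → ℝ) (t : ℝ) : E m →L[ℝ] E m :=
  ContinuousLinearMap.pi fun i => (t ^ w i) • ContinuousLinearMap.proj i

/-- `ω` is quasi-homogeneous of degree `δ` for the weights `w`: the pull-back of `ω` by the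
dilation with parameter `t` is `t^δ ω`, for every `t > 0`. -/
def IsQuasiHomogeneous {m p : ℕ} (w : Fin m → ℝ) (δ : ℝ) (ω : Form m p) : Prop :=
  ∀ t : ℝ, 0 < t → ∀ x : E m,
    (ω (dilation w t x)).compContinuousLinearMap (dilation w t) = (t ^ δ) • ω x

/-! ### The singularity `W_9` and the forms `θ_1, …, θ_9` -/

/-- The index in `Fin (2 * n)` of the coordinate `x_{k+1}`, for `k = 0, 1, 2`. -/
def idx {n : ℕ} (hn : 2 ≤ n) (k : Fin 3) : Fin (2 * n) := Fin.castLE (by omega) k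

/-- `W_9 = {x_1^2 + x_2 x_3^2 = x_2^2 + x_1 x_3 = 0, x_4 = ⋯ = x_{2n} = 0} ⊆ ℝ^{2n}`. -/
def W9 {n : ℕ} (hn : 2 ≤ n) : Set (E (2 * n)) :=
  {x | x (idx hn 0) ^ 2 + x (idx hn 1) * x (idx hn 2) ^ 2 = 0 ∧
    x (idx hn 1) ^ 2 + x (idx hn 0) * x (idx hn 2) = 0 ∧
    ∀ i : Fin (2 * n), 3 ≤ i.val → x i = 0}

/-- The constant `2`-form `dx_i ∧ dx_j`. -/
def dxdx {m : ℕ} (i j : Fin m) : (E m) [⋀^Fin 2]→L[ℝ] ℝ where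
  toFun v := v 0 i * v 1 j - v 0 j * v 1 i
  map_update_add' v k x y := by
    fin_cases k <;> simp <;> ring
  map_update_smul' v k c x := by
    fin_cases k <;> simp <;> ring
  cont := by fun_prop
  map_eq_zero_of_eq' v a b h hab := by
    fin_cases a <;> fin_cases b <;> simp_all <;> ring

theorem dxdx_apply {m : ℕ} (i j : Fin m) (v : Fin 2 → E m) :
    dxdx i j v = v 0 i * v 1 j - v 0 j * v 1 i := rfl

/-- The forms `θ_1, …, θ_9` (`theta hn k` is `θ_{k+1}`). -/
def theta {n : ℕ} (hn : 2 ≤ n) : Fin 9 → Form (2 * n) 2 :=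
  let x₁ := idx hn 0
  let x₂ := idx hn 1
  let x₃ := idx hn 2
  ![fun _ => dxdx x₂ x₃,
    fun _ => dxdx x₁ x₃,
    fun _ => dxdx x₁ x₂,
    fun x => x x₃ • dxdx x₂ x₃,
    fun x => x x₃ • dxdx x₁ x₃,
    fun x => x x₁ • dxdx x₂ x₃ + x x₂ • dxdx x₁ x₃,
    fun x => x x₃ ^ 2 • dxdx x₂ x₃,
    fun x => x x₃ ^ 2 • dxdx x₁ x₃,
    fun x => x x₃ ^ 3 • dxdx x₂ x₃]

/-- The quasi-degrees `δ_1, …, δ_9`. -/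
def delta : Fin 9 → ℝ := ![7, 8, 9, 10, 11, 12, 13, 14, 16]

theorem theta_contDiff {n : ℕ} (hn : 2 ≤ n) (k : Fin 9) : ContDiff ℝ ((⊤ : ℕ∞) : WithTop ℕ∞) (theta hn k) := by
  fin_cases k <;> simp only [theta] <;> simp <;> fun_prop

/-- The germ of `θ_{k+1}`. -/
def thetaGerm {n : ℕ} (hn : 2 ≤ n) (k : Fin 9) : Lam (2 * n) 2 :=
  germ (theta hn k) (Eventually.of_forall fun _ => (theta_contDiff hn k).contDiffAt)

end AlgRestr

end

/-!
Write `x, y, z` for the first three coordinates, with weights `5, 4, 3`, and `W3` for the set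
`f₁ = x² + yz² = 0`, `f₂ = y² + xz = 0` in `ℝ³`.

*Reduction to `ℝ³`.* Let `π` be the projection of `ℝ^{2n}` onto the space of the first three
coordinates, which contains `W_9`. Along `W_9` the form `ω - π^*ω` agrees with the differential of
a `1`-form obtained from `ω(x - πx, ·)`, which vanishes on `W_9` (`sub_pull_mem_A0`). Pullback by
the projection and by the inclusion therefore identify the algebraic restrictions to `W_9` with
those to `W3`.

*Spanning.* A closed `2`-form on `ℝ³` has a primitive that annihilates the Euler field `E`, and
that is divisible by `z^k` if the form is (`poincare`, `exists_primitive`). A `1`-form divisible by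
`z⁶` and annihilating `E` agrees along `W3` with the differential of a combination of `f₁` and `f₂`,
by Cramer's rule for the Jacobian matrix of `(f₁, f₂)` (`exists_vanishing_primitive`). Hence
differentials of `1`-forms divisible by `z⁷` have zero algebraic restriction (`K_flat`). On `W3`
the functions of quasi-degree at least `30` are multiples of `z⁷`, so that by Taylor's theorem only
the differentials of `x^i y^j z^k dx`, `x^i y^j z^k dy` and `x^i y^j z^k dz` remain. The relations
`x² = -yz²`, `y² = -xz` and `d(d(x^i y^j z^k)) = 0` express all of them through nine, which are the
classes of the `θ_k` (`mem_of_relations`, `restr_mem_span`).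

*Independence.* `W3` is the union of the third axis and the curve `(-t⁵, -t⁴, t³)`, both invariant
under the quasi-homogeneous dilations, so that every quasi-homogeneous part of a function vanishing
on `W3` vanishes on both branches. This gives linear relations between the Taylor coefficients of
such a function (`Jet.vanishing`), with which `∑ c_k θ_k = α + dβ` forces `c = 0` by comparison of
coefficients (`theta_coeff_eq_zero`).

*Symplectic forms.* A constant `2`-form that vanishes on `ℝ³` has zero algebraic restriction. For
`n ≥ 3`, adding `∑ dx_i ∧ dx_{i+n}` to `∑ c_k θ_k` gives a symplectic form. For `n = 2`, adding
`(c_1 dx_1 - c_2 dx_2 + c_3 dx_3) ∧ dx_4` gives a form with Pfaffian `c_1² + c_2² + c_3²` at the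
origin. Conversely, `α + dβ` vanishes at the origin, since functions vanishing on `W3` have zero
derivative there; if `c_1 = c_2 = c_3 = 0`, then `ℝ³` is isotropic at the origin for every form with
the algebraic restriction of `∑ c_k θ_k`, which is impossible for a nondegenerate form on `ℝ⁴`.
-/

open Filter Topology

noncomputable section

namespace AlgRestr

open scoped ContDiff
open MeasureTheory

/-! ### Smooth dependence of integrals on parameters -/

theorem hasFDerivAt_parametric_integral {H F : Type} [NormedAddCommGroup H] [NormedSpace ℝ H]
    [ProperSpace H] [NormedAddCommGroup F] [NormedSpace ℝ F] [CompleteSpace F]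
    {f : H → ℝ → F} (hf : ContDiff ℝ ∞ (Function.uncurry f)) (x₀ : H) :
    HasFDerivAt (fun x => ∫ s in (0 : ℝ)..1, f x s)
      (∫ s in (0 : ℝ)..1, fderiv ℝ (fun y => f y s) x₀) x₀ := by
  have hc : Continuous (Function.uncurry f) := hf.continuous
  have hd : Continuous fun p : H × ℝ => fderiv ℝ (fun y => f y p.2) p.1 := by
    have h : ContDiff ℝ 0 fun p : H × ℝ => fderiv ℝ (fun y => f y p.2) p.1 := by
      refine ContDiff.fderiv (n := 0) (m := ∞) (f := fun (p : H × ℝ) y => f y p.2) ?_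
        contDiff_fst (by simp)
      exact hf.comp (contDiff_snd.prodMk (contDiff_snd.comp contDiff_fst))
    exact h.continuous
  obtain ⟨C, hC⟩ := ((isCompact_closedBall x₀ 1).prod (isCompact_Icc (a := (0 : ℝ)) (b := 1)))
    |>.exists_bound_of_continuousOn hd.continuousOn
  refine intervalIntegral.hasFDerivAt_integral_of_dominated_of_fderiv_le
    (F' := fun x s => fderiv ℝ (fun y => f y s) x) (bound := fun _ => C)
    (Metric.closedBall_mem_nhds x₀ one_pos) ?_ ?_ ?_ ?_ ?_ ?_
  · exact Eventually.of_forall fun x =>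
      (hc.comp (Continuous.prodMk_right x)).aestronglyMeasurable
  · exact (hc.comp (Continuous.prodMk_right x₀)).intervalIntegrable _ _
  · exact (hd.comp (Continuous.prodMk_right x₀)).aestronglyMeasurable
  · refine Eventually.of_forall fun s hs x hx => hC (x, s) ⟨hx, ?_⟩
    rw [Set.uIoc_of_le zero_le_one] at hs
    exact ⟨hs.1.le, hs.2⟩
  · exact intervalIntegrable_const
  · refine Eventually.of_forall fun s _ x _ => ?_
    have : ContDiff ℝ ∞ fun y => f y s := hf.comp (contDiff_id.prodMk contDiff_const)
    exact (this.differentiable (by simp) x).hasFDerivAt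

/-- The induction on `n` varies the target space, since the derivative of the integral is the
integral of an operator-valued function. -/
theorem contDiff_parametric_integral_nat {H : Type} [NormedAddCommGroup H] [NormedSpace ℝ H]
    [ProperSpace H] (n : ℕ) : ∀ {F : Type} [NormedAddCommGroup F] [NormedSpace ℝ F]
    [CompleteSpace F] {f : H → ℝ → F} (_ : ContDiff ℝ ∞ (Function.uncurry f)),
    ContDiff ℝ n fun x => ∫ s in (0 : ℝ)..1, f x s := by
  induction n with
  | zero =>
    intro F _ _ _ f hf
    refine contDiff_zero.2 (continuous_iff_continuousAt.2 fun x => ?_)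
    exact (hasFDerivAt_parametric_integral hf x).continuousAt
  | succ n ih =>
    intro F _ _ _ f hf
    refine contDiff_succ_iff_hasFDerivAt.2 ⟨_, ?_, fun x => hasFDerivAt_parametric_integral hf x⟩
    refine ih (f := fun x s => fderiv ℝ (fun y => f y s) x) ?_
    refine ContDiff.fderiv (n := ∞) (m := ∞) (f := fun (p : H × ℝ) y => f y p.2) ?_
        contDiff_fst (by simp)
    exact hf.comp (contDiff_snd.prodMk (contDiff_snd.comp contDiff_fst))

theorem contDiff_parametric_integral {H F : Type} [NormedAddCommGroup H] [NormedSpace ℝ H]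
    [ProperSpace H] [NormedAddCommGroup F] [NormedSpace ℝ F] [CompleteSpace F]
    {f : H → ℝ → F} (hf : ContDiff ℝ ∞ (Function.uncurry f)) :
    ContDiff ℝ ∞ fun x => ∫ s in (0 : ℝ)..1, f x s :=
  contDiff_infty.2 fun n => contDiff_parametric_integral_nat n hf

/-! ### Partial derivatives and the weighted dilations of `ℝ³` -/

/-- The partial derivative `∂f/∂x_i`. -/
def pd (i : Fin 3) (f : E 3 → ℝ) (x : E 3) : ℝ := fderiv ℝ f x (Pi.single i 1)

theorem _root_.ContDiff.pd {f : E 3 → ℝ} (hf : ContDiff ℝ ∞ f) (i : Fin 3) :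
    ContDiff ℝ ∞ (pd i f) :=
  (hf.fderiv_right (by simp)).clm_apply contDiff_const

theorem fderiv_eq_pd (f : E 3 → ℝ) (x v : E 3) :
    fderiv ℝ f x v = v 0 * pd 0 f x + v 1 * pd 1 f x + v 2 * pd 2 f x := by
  have hv : v = v 0 • Pi.single 0 1 + v 1 • Pi.single 1 1 + v 2 • Pi.single 2 1 := by
    ext i; fin_cases i <;> simp
  conv_lhs => rw [hv]
  simp [pd]

section PartialDerivatives

variable {f g : E 3 → ℝ}

theorem _root_.ContDiff.diffAt (hf : ContDiff ℝ ∞ f) (x : E 3) : DifferentiableAt ℝ f x :=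
  hf.differentiable (by simp) x

theorem pd_add (hf : ContDiff ℝ ∞ f) (hg : ContDiff ℝ ∞ g) (i : Fin 3) (x : E 3) :
    pd i (fun y => f y + g y) x = pd i f x + pd i g x := by
  simp [pd, fderiv_fun_add (hf.diffAt x) (hg.diffAt x)]

theorem pd_sub (hf : ContDiff ℝ ∞ f) (hg : ContDiff ℝ ∞ g) (i : Fin 3) (x : E 3) :
    pd i (fun y => f y - g y) x = pd i f x - pd i g x := by
  simp [pd, fderiv_fun_sub (hf.diffAt x) (hg.diffAt x)]

theorem pd_mul (hf : ContDiff ℝ ∞ f) (hg : ContDiff ℝ ∞ g) (i : Fin 3) (x : E 3) :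
    pd i (fun y => f y * g y) x = pd i f x * g x + f x * pd i g x := by
  simp [pd, fderiv_fun_mul (hf.diffAt x) (hg.diffAt x)]; ring

theorem pd_const_mul (c : ℝ) (hf : ContDiff ℝ ∞ f) (i : Fin 3) (x : E 3) :
    pd i (fun y => c * f y) x = c * pd i f x := by
  simp [pd, fderiv_const_mul (hf.diffAt x)]

theorem pd_const (c : ℝ) (i : Fin 3) (x : E 3) : pd i (fun _ => c) x = 0 := by
  simp [pd]

theorem pd_coord (i j : Fin 3) (x : E 3) : pd i (fun y => y j) x = if j = i then 1 else 0 := by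
  have : HasFDerivAt (fun y : E 3 => y j) (ContinuousLinearMap.proj (R := ℝ) j) x :=
    (ContinuousLinearMap.proj (R := ℝ) (φ := fun _ : Fin 3 => ℝ) j).hasFDerivAt
  simp [pd, this.fderiv, Pi.single_apply]

theorem pd_pow (hf : ContDiff ℝ ∞ f) (n : ℕ) (i : Fin 3) (x : E 3) :
    pd i (fun y => f y ^ n) x = n * f x ^ (n - 1) * pd i f x := by
  simp [pd, fderiv_fun_pow n (hf.diffAt x)]

theorem pd_comm (hf : ContDiff ℝ ∞ f) (i j : Fin 3) (x : E 3) :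
    pd i (pd j f) x = pd j (pd i f) x := by
  have hs : IsSymmSndFDerivAt ℝ f x := hf.contDiffAt.isSymmSndFDerivAt
    (by simpa using WithTop.coe_le_coe.2 (le_top : (2 : ℕ∞) ≤ ⊤))
  have hd : DifferentiableAt ℝ (fderiv ℝ f) x :=
    ((hf.fderiv_right (m := ∞) (by simp)).differentiable (by simp)) x
  have key : ∀ v w : E 3, fderiv ℝ (fun y => fderiv ℝ f y v) x w = fderiv ℝ (fderiv ℝ f) x w v := by
    intro v w
    rw [fderiv_clm_apply hd (differentiableAt_const v)]
    simp
  exact (key _ _).trans ((hs.eq _ _).trans (key _ _).symm)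

end PartialDerivatives

/-- The weights `5, 4, 3` of the coordinates of `ℝ³`. -/
def wt3 : Fin 3 → ℕ := ![5, 4, 3]

/-- The quasi-homogeneous dilation of `ℝ³` with weights `5, 4, 3`. -/
def dil (s : ℝ) (x : E 3) : E 3 := fun i => s ^ wt3 i * x i

theorem dil_apply (s : ℝ) (x : E 3) (i : Fin 3) : dil s x i = s ^ wt3 i * x i := rfl

theorem dil_one (x : E 3) : dil 1 x = x := by ext i; simp [dil_apply]

theorem dil_zero (x : E 3) : dil 0 x = 0 := by
  ext i; fin_cases i <;> simp [dil_apply, wt3]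

theorem contDiff_dil : ContDiff ℝ ∞ fun p : E 3 × ℝ => dil p.2 p.1 := by
  unfold dil; fun_prop

theorem norm_dil_le {s : ℝ} (h0 : 0 ≤ s) (h1 : s ≤ 1) (x : E 3) : ‖dil s x‖ ≤ ‖x‖ := by
  refine (pi_norm_le_iff_of_nonneg (norm_nonneg x)).2 fun i => ?_
  rw [dil_apply, norm_mul, norm_pow, Real.norm_of_nonneg h0]
  calc s ^ wt3 i * ‖x i‖ ≤ 1 * ‖x i‖ := by
        gcongr; exact pow_le_one₀ h0 h1
    _ ≤ ‖x‖ := by rw [one_mul]; exact norm_le_pi_norm x i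

theorem pd_comp_dil {f : E 3 → ℝ} (hf : ContDiff ℝ ∞ f) (s : ℝ) (i : Fin 3) (x : E 3) :
    pd i (fun y => f (dil s y)) x = s ^ wt3 i * pd i f (dil s x) := by
  have hd : HasFDerivAt (dil s) (ContinuousLinearMap.pi fun j =>
      (s ^ wt3 j) • ContinuousLinearMap.proj (R := ℝ) (φ := fun _ : Fin 3 => ℝ) j) x :=
    (ContinuousLinearMap.pi fun j => (s ^ wt3 j) •
      ContinuousLinearMap.proj (R := ℝ) (φ := fun _ : Fin 3 => ℝ) j).hasFDerivAt
  have h := ((hf.diffAt (dil s x)).hasFDerivAt.comp x hd).fderiv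
  have h' : fderiv ℝ (fun y => f (dil s y)) x = _ := h
  rw [pd, h', ContinuousLinearMap.comp_apply, fderiv_eq_pd]
  fin_cases i <;> simp

theorem hasDerivAt_comp_dil {f : E 3 → ℝ} (hf : ContDiff ℝ ∞ f) (x : E 3) (s : ℝ) :
    HasDerivAt (fun s => f (dil s x)) (5 * s ^ 4 * x 0 * pd 0 f (dil s x) +
      4 * s ^ 3 * x 1 * pd 1 f (dil s x) + 3 * s ^ 2 * x 2 * pd 2 f (dil s x)) s := by
  have hd : HasDerivAt (fun s => dil s x) (fun i => (wt3 i * s ^ (wt3 i - 1)) * x i) s :=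
    hasDerivAt_pi.2 fun i => (hasDerivAt_pow (wt3 i) s).mul_const (x i)
  have h := (hf.diffAt (dil s x)).hasFDerivAt.comp_hasDerivAt s hd
  rw [fderiv_eq_pd] at h
  refine h.congr_deriv ?_
  simp [wt3]

/-! ### The weighted averages `J a f` -/

/-- The weighted average `x ↦ ∫₀¹ s^a f(F_s x) ds` along the dilations `F_s`. -/
def J (a : ℕ) (f : E 3 → ℝ) (x : E 3) : ℝ := ∫ s in (0 : ℝ)..1, s ^ a * f (dil s x)

theorem contDiff_J_integrand (a : ℕ) {f : E 3 → ℝ} (hf : ContDiff ℝ ∞ f) :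
    ContDiff ℝ ∞ (Function.uncurry fun (x : E 3) (s : ℝ) => s ^ a * f (dil s x)) :=
  (contDiff_snd.pow a).mul (hf.comp contDiff_dil)

theorem J_smooth (a : ℕ) {f : E 3 → ℝ} (hf : ContDiff ℝ ∞ f) : ContDiff ℝ ∞ (J a f) :=
  contDiff_parametric_integral (contDiff_J_integrand a hf)

theorem J_integrable (a : ℕ) {f : E 3 → ℝ} (hf : ContDiff ℝ ∞ f) (x : E 3) :
    IntervalIntegrable (fun s => s ^ a * f (dil s x)) volume 0 1 :=
  ((contDiff_J_integrand a hf).continuous.comp (Continuous.prodMk_right x)).intervalIntegrable _ _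

theorem comp_dil_smooth {f : E 3 → ℝ} (hf : ContDiff ℝ ∞ f) (s : ℝ) :
    ContDiff ℝ ∞ fun y => f (dil s y) :=
  hf.comp (contDiff_dil.comp (contDiff_id.prodMk contDiff_const))

theorem pd_J (a : ℕ) {f : E 3 → ℝ} (hf : ContDiff ℝ ∞ f) (i : Fin 3) (x : E 3) :
    pd i (J a f) x = J (a + wt3 i) (pd i f) x := by
  have h := (hasFDerivAt_parametric_integral (contDiff_J_integrand a hf) x).fderiv
  have h' : fderiv ℝ (J a f) x = _ := h
  have hd : Continuous fun s => fderiv ℝ (fun y => s ^ a * f (dil s y)) x := by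
    have h : ContDiff ℝ 0 fun s : ℝ => fderiv ℝ (fun y => s ^ a * f (dil s y)) x := by
      refine ContDiff.fderiv (n := 0) (m := ∞)
        (f := fun (s : ℝ) y => s ^ a * f (dil s y)) ?_ contDiff_const (by simp)
      exact (contDiff_J_integrand a hf).comp (contDiff_snd.prodMk contDiff_fst)
    exact h.continuous
  rw [pd, h', ContinuousLinearMap.intervalIntegral_apply (hd.intervalIntegrable _ _), J]
  refine intervalIntegral.integral_congr fun s _ => ?_
  have := pd_const_mul (s ^ a) (comp_dil_smooth hf s) i x
  rw [pd_comp_dil hf] at this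
  simp only [pow_add, mul_assoc]
  exact this

theorem J_add (a : ℕ) {f g : E 3 → ℝ} (hf : ContDiff ℝ ∞ f) (hg : ContDiff ℝ ∞ g) (x : E 3) :
    J a (fun y => f y + g y) x = J a f x + J a g x := by
  simp only [J, mul_add]
  exact intervalIntegral.integral_add (J_integrable a hf x) (J_integrable a hg x)

theorem J_eq_zero (a : ℕ) {f : E 3 → ℝ} {r : ℝ} (hf : ∀ x, ‖x‖ ≤ r → f x = 0) {x : E 3}
    (hx : ‖x‖ ≤ r) : J a f x = 0 := by
  refine Eq.trans (intervalIntegral.integral_congr (g := fun _ => (0 : ℝ)) fun s hs => ?_)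
    intervalIntegral.integral_zero
  rw [Set.uIcc_of_le zero_le_one] at hs
  simp only [hf _ ((norm_dil_le hs.1 hs.2 x).trans hx), mul_zero]

theorem J_pow_mul (a k : ℕ) (f : E 3 → ℝ) (x : E 3) :
    J a (fun y => y 2 ^ k * f y) x = x 2 ^ k * J (a + 3 * k) f x := by
  rw [J, J, ← intervalIntegral.integral_const_mul]
  refine intervalIntegral.integral_congr fun s _ => ?_
  simp only [dil_apply, wt3, Matrix.cons_val]
  ring

/-- The fundamental theorem of calculus for `s ↦ s ^ n * f (F_s x)` on `[0, 1]`; the term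
`0 ^ n * f 0` is present only for `n = 0`. -/
theorem J_ftc (n : ℕ) {f : E 3 → ℝ} (hf : ContDiff ℝ ∞ f) (x : E 3) :
    n * J (n - 1) f x + (5 * x 0 * J (n + 4) (pd 0 f) x + 4 * x 1 * J (n + 3) (pd 1 f) x +
      3 * x 2 * J (n + 2) (pd 2 f) x) = f x - 0 ^ n * f 0 := by
  have hder : ∀ s ∈ Set.uIcc (0 : ℝ) 1, HasDerivAt (fun s => s ^ n * f (dil s x))
      (n * (s ^ (n - 1) * f (dil s x)) + (5 * x 0 * (s ^ (n + 4) * pd 0 f (dil s x)) +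
        4 * x 1 * (s ^ (n + 3) * pd 1 f (dil s x)) +
        3 * x 2 * (s ^ (n + 2) * pd 2 f (dil s x)))) s := by
    intro s _
    refine ((hasDerivAt_pow n s).mul (hasDerivAt_comp_dil hf x s)).congr_deriv ?_
    ring
  have i0 := (J_integrable (n - 1) hf x).const_mul (n : ℝ)
  have i1 := (J_integrable (n + 4) (hf.pd 0) x).const_mul (5 * x 0)
  have i2 := (J_integrable (n + 3) (hf.pd 1) x).const_mul (4 * x 1)
  have i3 := (J_integrable (n + 2) (hf.pd 2) x).const_mul (3 * x 2)
  have h := intervalIntegral.integral_eq_sub_of_hasDerivAt hder (i0.add ((i1.add i2).add i3))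
  rw [intervalIntegral.integral_add i0 ((i1.add i2).add i3),
    intervalIntegral.integral_add (i1.add i2) i3, intervalIntegral.integral_add i1 i2] at h
  simp only [intervalIntegral.integral_const_mul] at h
  simpa [dil_one, dil_zero, J] using h

/-- Hadamard's lemma. -/
theorem hadamard {f : E 3 → ℝ} (hf : ContDiff ℝ ∞ f) :
    ∃ g : Fin 3 → E 3 → ℝ, (∀ i, ContDiff ℝ ∞ (g i)) ∧
      ∀ x, f x = f 0 + x 0 * g 0 x + x 1 * g 1 x + x 2 * g 2 x := by
  refine ⟨![fun x => 5 * J 4 (pd 0 f) x, fun x => 4 * J 3 (pd 1 f) x,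
    fun x => 3 * J 2 (pd 2 f) x], fun i => ?_, fun x => ?_⟩
  · fin_cases i
    · exact contDiff_const.mul (J_smooth 4 (hf.pd 0))
    · exact contDiff_const.mul (J_smooth 3 (hf.pd 1))
    · exact contDiff_const.mul (J_smooth 2 (hf.pd 2))
  · have := J_ftc 0 hf x
    simp at this ⊢
    linarith

/-- The Euler identity for the averages: `(a + 1) J_a f + E · ∇ J_a f = f`. -/
theorem J_euler (a : ℕ) {f : E 3 → ℝ} (hf : ContDiff ℝ ∞ f) (x : E 3) :
    (a + 1) * J a f x + (5 * x 0 * pd 0 (J a f) x + 4 * x 1 * pd 1 (J a f) x +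
      3 * x 2 * pd 2 (J a f) x) = f x := by
  have := J_ftc (a + 1) hf x
  simp only [pd_J a hf]
  simp [wt3] at this ⊢
  linarith

/-! ### A quasi-homogeneous Poincaré lemma -/

theorem coord_smooth (i : Fin 3) : ContDiff ℝ ∞ fun y : E 3 => y i := contDiff_apply ℝ ℝ i

/-- If `A dy∧dz + B dx∧dz + C dx∧dy` is closed on a ball, then it has there an explicit primitive,
the integral of its contraction with the Euler field along the dilations. -/
theorem poincare {A B C : E 3 → ℝ} (hA : ContDiff ℝ ∞ A) (hB : ContDiff ℝ ∞ B)
    (hC : ContDiff ℝ ∞ C) {ρ : ℝ}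
    (hdiv : ∀ x, ‖x‖ ≤ ρ → pd 0 A x - pd 1 B x + pd 2 C x = 0)
    {p q r : E 3 → ℝ} (hp : p = fun x => -(3 * x 2 * J 7 B x) - 4 * x 1 * J 8 C x)
    (hq : q = fun x => 5 * x 0 * J 8 C x - 3 * x 2 * J 6 A x)
    (hr : r = fun x => 4 * x 1 * J 6 A x + 5 * x 0 * J 7 B x) {x : E 3} (hx : ‖x‖ ≤ ρ) :
    pd 1 r x - pd 2 q x = A x ∧ pd 0 r x - pd 2 p x = B x ∧ pd 0 q x - pd 1 p x = C x := by
  have eA := J_euler 6 hA x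
  have eB := J_euler 7 hB x
  have eC := J_euler 8 hC x
  -- the three derivatives are averages with the same weight `s ^ 11`, as `6 + 5 = 7 + 4 = 8 + 3`
  have hd : pd 0 (J 6 A) x - pd 1 (J 7 B) x + pd 2 (J 8 C) x = 0 := by
    have h := J_eq_zero 11 hdiv hx
    have e : (fun x => pd 0 A x - pd 1 B x + pd 2 C x) =
        fun x => (pd 0 A x + -1 * pd 1 B x) + pd 2 C x := by ext; ring
    have hB' : ContDiff ℝ ∞ fun x => -1 * pd 1 B x := contDiff_const.mul (hB.pd 1)
    rw [e, J_add 11 ((hA.pd 0).add hB') (hC.pd 2), J_add 11 (hA.pd 0) hB'] at h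
    have h1 : J 11 (fun x => -1 * pd 1 B x) x = -1 * J 11 (pd 1 B) x := by
      rw [J, J, ← intervalIntegral.integral_const_mul]
      congr 1; ext s; ring
    rw [h1] at h
    rw [pd_J 6 hA, pd_J 7 hB, pd_J 8 hC]
    simp only [wt3, Matrix.cons_val]
    linarith
  have sA := J_smooth 6 hA
  have sB := J_smooth 7 hB
  have sC := J_smooth 8 hC
  generalize J 6 A = a at *
  generalize J 7 B = b at *
  generalize J 8 C = c at *
  have e1 : ∀ (k : ℝ) (j : Fin 3) (f : E 3 → ℝ) (_ : ContDiff ℝ ∞ f) (i : Fin 3),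
      pd i (fun y => k * y j * f y) x = k * (if j = i then 1 else 0) * f x + k * x j * pd i f x := by
    intro k j f hf i
    rw [pd_mul (contDiff_const.mul (coord_smooth j)) hf, pd_const_mul k (coord_smooth j), pd_coord]
  have sm : ∀ (k : ℝ) (j : Fin 3) (f : E 3 → ℝ) (_ : ContDiff ℝ ∞ f),
      ContDiff ℝ ∞ fun y : E 3 => k * y j * f y := fun k j f hf =>
    (contDiff_const.mul (coord_smooth j)).mul hf
  have hp' : p = fun x => -3 * x 2 * b x - 4 * x 1 * c x := by rw [hp]; ext; ring
  have dp : ∀ i, pd i p x = _ := fun i => by rw [hp', pd_sub (sm _ _ _ sB) (sm _ _ _ sC) i,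
    e1 _ _ _ sB, e1 _ _ _ sC]
  have dq : ∀ i, pd i q x = _ := fun i => by rw [hq, pd_sub (sm _ _ _ sC) (sm _ _ _ sA) i,
    e1 _ _ _ sC, e1 _ _ _ sA]
  have dr : ∀ i, pd i r x = _ := fun i => by rw [hr, pd_add (sm _ _ _ sA) (sm _ _ _ sB) i,
    e1 _ _ _ sA, e1 _ _ _ sB]
  simp only [dp, dq, dr]
  norm_num at eA eB eC
  refine ⟨?_, ?_, ?_⟩ <;> simp
  · linear_combination eA - 5 * x 0 * hd
  · linear_combination eB + 4 * x 1 * hd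
  · linear_combination eC - 3 * x 2 * hd

/-- The primitive can be chosen to annihilate the Euler field and to be divisible by every power
of the third coordinate that divides the given form. -/
theorem exists_primitive (k : ℕ) {A B C : E 3 → ℝ} (hA : ContDiff ℝ ∞ A) (hB : ContDiff ℝ ∞ B)
    (hC : ContDiff ℝ ∞ C) {ρ : ℝ} (hdiv : ∀ x, ‖x‖ ≤ ρ → pd 0 (fun y => y 2 ^ k * A y) x -
      pd 1 (fun y => y 2 ^ k * B y) x + pd 2 (fun y => y 2 ^ k * C y) x = 0) :
    ∃ p q r : E 3 → ℝ, ContDiff ℝ ∞ p ∧ ContDiff ℝ ∞ q ∧ ContDiff ℝ ∞ r ∧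
      (∀ x, 5 * x 0 * p x + 4 * x 1 * q x + 3 * x 2 * r x = 0) ∧
      ∀ x, ‖x‖ ≤ ρ →
        pd 1 (fun y => y 2 ^ k * r y) x - pd 2 (fun y => y 2 ^ k * q y) x = x 2 ^ k * A x ∧
        pd 0 (fun y => y 2 ^ k * r y) x - pd 2 (fun y => y 2 ^ k * p y) x = x 2 ^ k * B x ∧
        pd 0 (fun y => y 2 ^ k * q y) x - pd 1 (fun y => y 2 ^ k * p y) x = x 2 ^ k * C x := by
  have hz : ContDiff ℝ ∞ fun y : E 3 => y 2 ^ k := (coord_smooth 2).pow k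
  have sA := J_smooth (6 + 3 * k) hA
  have sB := J_smooth (7 + 3 * k) hB
  have sC := J_smooth (8 + 3 * k) hC
  refine ⟨fun x => -(3 * x 2 * J (7 + 3 * k) B x) - 4 * x 1 * J (8 + 3 * k) C x,
    fun x => 5 * x 0 * J (8 + 3 * k) C x - 3 * x 2 * J (6 + 3 * k) A x,
    fun x => 4 * x 1 * J (6 + 3 * k) A x + 5 * x 0 * J (7 + 3 * k) B x,
    by fun_prop, by fun_prop, by fun_prop, fun x => by ring, fun x hx => ?_⟩
  refine poincare (hz.mul hA) (hz.mul hB) (hz.mul hC) hdiv ?_ ?_ ?_ hx <;>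
  · ext y
    simp only [J_pow_mul]
    ring

/-! ### The curve `W_9` in `ℝ³` -/

/-- `W_9` as a subset of `ℝ³`. -/
def W3 : Set (E 3) := {x | x 0 ^ 2 + x 1 * x 2 ^ 2 = 0 ∧ x 1 ^ 2 + x 0 * x 2 = 0}

/-- A `1`-form `z⁶ (p dx + q dy + r dz)` annihilating the Euler field agrees along `W3`
with the differential of a function vanishing on `W3`. -/
theorem exists_vanishing_primitive {p q r : E 3 → ℝ} (hp : ContDiff ℝ ∞ p)
    (hq : ContDiff ℝ ∞ q) (hr : ∀ x, 5 * x 0 * p x + 4 * x 1 * q x + 3 * x 2 * r x = 0) :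
    ∃ φ : E 3 → ℝ, ContDiff ℝ ∞ φ ∧ ∀ x ∈ W3, pd 0 φ x = x 2 ^ 6 * p x ∧
      pd 1 φ x = x 2 ^ 6 * q x ∧ pd 2 φ x = x 2 ^ 6 * r x := by
  -- Cramer's rule for `a df₁ + b df₂ = z⁶ (p, q, r)`: the minor `4xy - z³` of the Jacobian matrix
  -- becomes `z⁶` on `W3` when multiplied by `4/3 xy - z³`
  set a : E 3 → ℝ := fun x => (4 / 3 * x 0 * x 1 - x 2 ^ 3) * (2 * x 1 * p x - x 2 * q x) with ha
  set b : E 3 → ℝ := fun x => (4 / 3 * x 0 * x 1 - x 2 ^ 3) * (2 * x 0 * q x - x 2 ^ 2 * p x)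
    with hb
  have sa : ContDiff ℝ ∞ a := by rw [ha]; fun_prop
  have sb : ContDiff ℝ ∞ b := by rw [hb]; fun_prop
  have s0 := coord_smooth 0
  have s1 := coord_smooth 1
  have s2 := coord_smooth 2
  have sf : ContDiff ℝ ∞ fun x : E 3 => x 0 ^ 2 + x 1 * x 2 ^ 2 := by fun_prop
  have sg : ContDiff ℝ ∞ fun x : E 3 => x 1 ^ 2 + x 0 * x 2 := by fun_prop
  have df : ∀ i x, pd i (fun x : E 3 => x 0 ^ 2 + x 1 * x 2 ^ 2) x = _ := fun i x => by
    rw [pd_add (s0.pow 2) (s1.mul (s2.pow 2)), pd_pow s0, pd_mul s1 (s2.pow 2), pd_pow s2,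
      pd_coord, pd_coord, pd_coord]
  have dg : ∀ i x, pd i (fun x : E 3 => x 1 ^ 2 + x 0 * x 2) x = _ := fun i x => by
    rw [pd_add (s1.pow 2) (s0.mul s2), pd_pow s1, pd_mul s0 s2,
      pd_coord, pd_coord, pd_coord]
  refine ⟨fun x => a x * (x 0 ^ 2 + x 1 * x 2 ^ 2) + b x * (x 1 ^ 2 + x 0 * x 2),
    (sa.mul sf).add (sb.mul sg), fun x hx => ?_⟩
  obtain ⟨h1, h2⟩ := hx
  have h3 := hr x
  simp only [pd_add (sa.mul sf) (sb.mul sg), pd_mul sa sf, pd_mul sb sg, df, dg, h1, h2]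
  simp only [ha, hb]
  refine ⟨?_, ?_, ?_⟩ <;> simp
  · linear_combination (16 / 3 * x 1 ^ 2 * p x) * h1 - 16 / 3 * (x 1 * x 2 ^ 2 * p x) * h2
  · linear_combination (16 / 3 * x 1 ^ 2 * q x) * h1 - 16 / 3 * (x 1 * x 2 ^ 2 * q x) * h2
  · linear_combination
      (2 * (4 / 3 * x 0 * x 1 - x 2 ^ 3) * q x + 4 / 3 * x 2 ^ 2 * (4 * q x * x 2 - 5 * p x * x 1))
        * h1 + (4 * (4 / 3 * x 0 * x 1 - x 2 ^ 3) * x 2 * p x +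
          4 / 3 * x 2 ^ 2 * (5 * p x * x 2 ^ 2 - 4 * q x * x 0)) * h2 +
      (-x 2 ^ 2 * (4 / 3 * x 0 * x 1 - x 2 ^ 3) + 4 / 3 * x 2 ^ 2 * (x 0 * x 1 - x 2 ^ 3)) * h3

/-! ### Differential forms on `ℝ³` in coordinates -/

/-- The constant `1`-form `dx_i`. -/
def dx {m : ℕ} (i : Fin m) : (E m) [⋀^Fin 1]→L[ℝ] ℝ :=
  ContinuousAlternatingMap.ofSubsingleton ℝ (E m) ℝ 0 (ContinuousLinearMap.proj i)

theorem dx_apply {m : ℕ} (i : Fin m) (v : Fin 1 → E m) : dx i v = v 0 i := rfl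

/-- The `1`-form `p dx + q dy + r dz` on `ℝ³`. -/
def form1 (p q r : E 3 → ℝ) : Form 3 1 := fun x => p x • dx 0 + q x • dx 1 + r x • dx 2

/-- The `2`-form `A dy∧dz + B dx∧dz + C dx∧dy` on `ℝ³`. -/
def form2 (A B C : E 3 → ℝ) : Form 3 2 := fun x =>
  A x • dxdx 1 2 + B x • dxdx 0 2 + C x • dxdx 0 1

theorem form1_apply (p q r : E 3 → ℝ) (x : E 3) (v : Fin 1 → E 3) :
    form1 p q r x v = p x * v 0 0 + q x * v 0 1 + r x * v 0 2 := rfl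

theorem form2_apply (A B C : E 3 → ℝ) (x : E 3) (v : Fin 2 → E 3) :
    form2 A B C x v = A x * (v 0 1 * v 1 2 - v 0 2 * v 1 1) +
      B x * (v 0 0 * v 1 2 - v 0 2 * v 1 0) + C x * (v 0 0 * v 1 1 - v 0 1 * v 1 0) := rfl

theorem form1_contDiff {p q r : E 3 → ℝ} (hp : ContDiff ℝ ∞ p) (hq : ContDiff ℝ ∞ q)
    (hr : ContDiff ℝ ∞ r) : ContDiff ℝ ∞ (form1 p q r) := by
  unfold form1; fun_prop

theorem form2_contDiff {A B C : E 3 → ℝ} (hA : ContDiff ℝ ∞ A) (hB : ContDiff ℝ ∞ B)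
    (hC : ContDiff ℝ ∞ C) : ContDiff ℝ ∞ (form2 A B C) := by
  unfold form2; fun_prop

theorem vec3_eq (v : E 3) :
    v = v 0 • Pi.single 0 1 + v 1 • Pi.single 1 1 + v 2 • Pi.single 2 1 := by
  ext i; fin_cases i <;> simp

theorem update_one {m : ℕ} (a b : E m) : Function.update ![a] 0 b = ![b] := by
  ext i; fin_cases i; rfl

theorem update_pair {m : ℕ} (a b w : E m) : Function.update ![a, w] 0 b = ![b, w] := by
  ext i; fin_cases i <;> rfl

theorem oneForm_eq (η : (E 3) [⋀^Fin 1]→L[ℝ] ℝ) :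
    η = η ![Pi.single 0 1] • dx 0 + η ![Pi.single 1 1] • dx 1 + η ![Pi.single 2 1] • dx 2 := by
  have key : ∀ v : E 3, η ![v] = v 0 * η ![Pi.single 0 1] + v 1 * η ![Pi.single 1 1] +
      v 2 * η ![Pi.single 2 1] := by
    intro v
    let L : E 3 →ₗ[ℝ] ℝ :=
      { toFun := fun v => η ![v]
        map_add' := fun a b => by
          simpa only [update_one] using η.map_update_add ![0] 0 a b
        map_smul' := fun c a => by
          simpa only [update_one, RingHom.id_apply] using η.map_update_smul ![0] 0 c a }
    have : L v = v 0 * L (Pi.single 0 1) + v 1 * L (Pi.single 1 1) + v 2 * L (Pi.single 2 1) := by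
      conv_lhs => rw [vec3_eq v]
      simp only [map_add, map_smul, smul_eq_mul]
    exact this
  ext v
  have hv : v = ![v 0] := by ext i; fin_cases i; rfl
  rw [hv, key]
  simp [dx_apply]
  ring

theorem twoForm_add_left {m : ℕ} (η : (E m) [⋀^Fin 2]→L[ℝ] ℝ) (a b w : E m) :
    η ![a + b, w] = η ![a, w] + η ![b, w] := by
  simpa only [update_pair] using η.map_update_add ![0, w] 0 a b

theorem twoForm_smul_left {m : ℕ} (η : (E m) [⋀^Fin 2]→L[ℝ] ℝ) (c : ℝ) (a w : E m) :
    η ![c • a, w] = c * η ![a, w] := by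
  simpa only [update_pair, smul_eq_mul] using η.map_update_smul ![0, w] 0 c a

theorem twoForm_swap {m : ℕ} (η : (E m) [⋀^Fin 2]→L[ℝ] ℝ) (a b : E m) :
    η ![a, b] = -η ![b, a] := by
  have := η.toAlternatingMap.map_swap ![b, a] (i := 0) (j := 1) (by decide)
  have e : ![b, a] ∘ Equiv.swap (0 : Fin 2) 1 = ![a, b] := by
    ext i; fin_cases i <;> simp
  rw [e] at this
  exact this

theorem twoForm_self {m : ℕ} (η : (E m) [⋀^Fin 2]→L[ℝ] ℝ) (a : E m) : η ![a, a] = 0 :=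
  η.map_eq_zero_of_eq ![a, a] (i := 0) (j := 1) rfl (by decide)

theorem twoForm_add_right {m : ℕ} (η : (E m) [⋀^Fin 2]→L[ℝ] ℝ) (a b w : E m) :
    η ![w, a + b] = η ![w, a] + η ![w, b] := by
  rw [twoForm_swap, twoForm_add_left, twoForm_swap η w a, twoForm_swap η w b]; ring

theorem twoForm_smul_right {m : ℕ} (η : (E m) [⋀^Fin 2]→L[ℝ] ℝ) (c : ℝ) (a w : E m) :
    η ![w, c • a] = c * η ![w, a] := by
  rw [twoForm_swap, twoForm_smul_left, twoForm_swap η w a]; ring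

theorem pair_eta {m : ℕ} (v : Fin 2 → E m) : ![v 0, v 1] = v := by
  ext i; fin_cases i <;> rfl

theorem twoForm_eq (η : (E 3) [⋀^Fin 2]→L[ℝ] ℝ) :
    η = η ![Pi.single 1 1, Pi.single 2 1] • dxdx 1 2 + η ![Pi.single 0 1, Pi.single 2 1] • dxdx 0 2
      + η ![Pi.single 0 1, Pi.single 1 1] • dxdx 0 1 := by
  ext v
  rw [← pair_eta v]
  generalize v 0 = a
  generalize v 1 = b
  conv_lhs => rw [vec3_eq a, vec3_eq b]
  simp only [twoForm_add_left, twoForm_add_right, twoForm_smul_left, twoForm_smul_right,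
    twoForm_self]
  rw [twoForm_swap η (Pi.single 1 1) (Pi.single 0 1), twoForm_swap η (Pi.single 2 1) (Pi.single 0 1),
    twoForm_swap η (Pi.single 2 1) (Pi.single 1 1)]
  simp [dxdx_apply]
  ring

theorem extDeriv_form1 {p q r : E 3 → ℝ} (hp : ContDiff ℝ ∞ p) (hq : ContDiff ℝ ∞ q)
    (hr : ContDiff ℝ ∞ r) : extDeriv (form1 p q r) =
      form2 (fun x => pd 1 r x - pd 2 q x) (fun x => pd 0 r x - pd 2 p x)
        (fun x => pd 0 q x - pd 1 p x) := by
  ext x v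
  rw [extDeriv_apply ((form1_contDiff hp hq hr).differentiable (by simp) x)]
  have key : ∀ a b : E 3, fderiv ℝ (fun y => p y * a 0 + q y * a 1 + r y * a 2) x b =
      fderiv ℝ p x b * a 0 + fderiv ℝ q x b * a 1 + fderiv ℝ r x b * a 2 := by
    intro a b
    have h1 := (((hp.diffAt x).hasFDerivAt.mul_const (a 0)).add
      ((hq.diffAt x).hasFDerivAt.mul_const (a 1))).add ((hr.diffAt x).hasFDerivAt.mul_const (a 2))
    have h2 : fderiv ℝ (fun y => p y * a 0 + q y * a 1 + r y * a 2) x = _ := h1.fderiv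
    rw [h2]
    simp [mul_comm]
  rw [Fin.sum_univ_two]
  simp only [form1_apply, key]
  rw [form2_apply]
  simp only [fderiv_eq_pd]
  simp [Fin.removeNth]
  ring

/-- The coefficients of a closed `2`-form on `ℝ³` satisfy the divergence equation. -/
theorem divergence_of_extDeriv_eq_zero {η : Form 3 2} {A B C : E 3 → ℝ} {x : E 3}
    (hη : DifferentiableAt ℝ η x) (h : extDeriv η x = 0) (e : η =ᶠ[𝓝 x] form2 A B C) :
    pd 0 A x - pd 1 B x + pd 2 C x = 0 := by
  have h0 := congrArg (fun α => α ![Pi.single 0 1, Pi.single 1 1, Pi.single 2 1]) h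
  simp only [extDeriv_apply hη] at h0
  rw [Fin.sum_univ_three] at h0
  have c : ∀ (v : Fin 2 → E 3) (w : E 3),
      fderiv ℝ (fun y => η y v) x w = fderiv ℝ (fun y => form2 A B C y v) x w := fun v w => by
    have : (fun y => η y v) =ᶠ[𝓝 x] fun y => form2 A B C y v := e.mono fun y hy => by
      simp only [hy]
    rw [this.fderiv_eq]
  simp only [c, form2_apply] at h0
  have s21 : Fin.succAbove (2 : Fin 3) (1 : Fin 2) = 1 := rfl
  simp [Fin.removeNth, s21] at h0
  simp only [pd]
  linarith

/-! ### Smooth germs extend to smooth functions -/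

/-- Multiplication by a bump function extends the germ of a smooth function to `ℝ³`. -/
theorem exists_smooth_extension {f : E 3 → ℝ}
    (hf : ∀ᶠ x in 𝓝 (0 : E 3), ContDiffAt ℝ ∞ f x) :
    ∃ g : E 3 → ℝ, ContDiff ℝ ∞ g ∧ f =ᶠ[𝓝 0] g := by
  obtain ⟨ε, hε, hb⟩ := Metric.eventually_nhds_iff_ball.1 hf
  let φ : ContDiffBump (0 : E 3) := ⟨ε / 4, ε / 2, by positivity, by linarith⟩
  refine ⟨fun x => φ x * f x, contDiff_iff_contDiffAt.2 fun x => ?_, ?_⟩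
  · by_cases hx : x ∈ Metric.ball (0 : E 3) ε
    · exact φ.contDiff.contDiffAt.mul (hb x hx)
    · have : (fun y => φ y * f y) =ᶠ[𝓝 x] fun _ => 0 := by
        have hx' : x ∉ tsupport φ := by
          rw [φ.tsupport_eq]
          intro h
          refine hx (Metric.closedBall_subset_ball ?_ h)
          show ε / 2 < ε
          linarith
        filter_upwards [notMem_tsupport_iff_eventuallyEq.1 hx'] with y hy
        simp [hy]
      exact contDiffAt_const.congr_of_eventuallyEq this
  · filter_upwards [φ.eventuallyEq_one] with x hx
    simp [hx]

/-! ### Reduction of polynomial `1`-forms along the curve -/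

/-- The relations `x² = -yz²` and `y² = -xz` reduce every monomial to `x^i y^j z^k` with
`i, j ≤ 1`. -/
theorem mem_of_reduction {V : Type*} [AddCommGroup V] [Module ℝ V] {F : ℕ → ℕ → ℕ → V}
    (h1 : ∀ i j k, F (i + 2) j k = -F i (j + 1) (k + 2))
    (h2 : ∀ i j k, F i (j + 2) k = -F (i + 1) j (k + 1)) {U : Submodule ℝ V}
    (h00 : ∀ k, F 0 0 k ∈ U) (h10 : ∀ k, F 1 0 k ∈ U) (h01 : ∀ k, F 0 1 k ∈ U)
    (h11 : ∀ k, F 1 1 k ∈ U) (i j k : ℕ) : F i j k ∈ U := by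
  induction hn : i + j using Nat.strong_induction_on generalizing i j k with
  | _ n ih =>
  match i, j with
  | i + 2, j => rw [h1]; exact U.neg_mem (ih (i + (j + 1)) (by omega) _ _ _ rfl)
  | i, j + 2 => rw [h2]; exact U.neg_mem (ih (i + 1 + j) (by omega) _ _ _ rfl)
  | 0, 0 => exact h00 k
  | 1, 0 => exact h10 k
  | 0, 1 => exact h01 k
  | 1, 1 => exact h11 k

/-- Here `X i j k`, `Y i j k`, `Z i j k` stand for the classes of the differentials of
`x^i y^j z^k dx`, `x^i y^j z^k dy`, `x^i y^j z^k dz`. The relations among them are those of the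
ring of functions on the curve and the vanishing of `d(d(x^i y^j z^k))`; nine classes generate. -/
theorem mem_of_relations {V : Type*} [AddCommGroup V] [Module ℝ V] {X Y Z : ℕ → ℕ → ℕ → V}
    (hX1 : ∀ i j k, X (i + 2) j k = -X i (j + 1) (k + 2))
    (hX2 : ∀ i j k, X i (j + 2) k = -X (i + 1) j (k + 1))
    (hY1 : ∀ i j k, Y (i + 2) j k = -Y i (j + 1) (k + 2))
    (hY2 : ∀ i j k, Y i (j + 2) k = -Y (i + 1) j (k + 1))
    (hZ1 : ∀ i j k, Z (i + 2) j k = -Z i (j + 1) (k + 2))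
    (hZ2 : ∀ i j k, Z i (j + 2) k = -Z (i + 1) j (k + 1))
    (h : ∀ i j k : ℕ,
      (i : ℝ) • X (i - 1) j k + (j : ℝ) • Y i (j - 1) k + (k : ℝ) • Z i j (k - 1) = 0)
    {U : Submodule ℝ V} (hb : ∀ k < 4, Z 0 1 k ∈ U) (ha : ∀ k < 3, Z 1 0 k ∈ U)
    (he : Z 1 1 0 ∈ U) (hu : Y 1 0 0 ∈ U) (i j k : ℕ) :
    X i j k ∈ U ∧ Y i j k ∈ U ∧ Z i j k ∈ U := by
  -- the derivatives in `z` of `x^i y^j z^k`, `i + j ≤ 4`, reduced to monomials with `i, j ≤ 1`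
  have z20 : ∀ k : ℕ, (k : ℝ) • Z 2 0 (k - 1) = -((k : ℝ) • Z 0 1 (k + 1)) := by
    rintro (_ | k)
    · simp
    · simp only [Nat.add_sub_cancel, hZ1 0 0, smul_neg]
  have z02 : ∀ k : ℕ, (k : ℝ) • Z 0 2 (k - 1) = -((k : ℝ) • Z 1 0 k) := by
    rintro (_ | k)
    · simp
    · simp only [Nat.add_sub_cancel, hZ2 0 0, smul_neg]
  have z21 : ∀ k : ℕ, (k : ℝ) • Z 2 1 (k - 1) = (k : ℝ) • Z 1 0 (k + 2) := by
    rintro (_ | k)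
    · simp
    · simp only [Nat.add_sub_cancel, hZ1 0 1, hZ2 0 0, neg_neg]
  have z12 : ∀ k : ℕ, (k : ℝ) • Z 1 2 (k - 1) = (k : ℝ) • Z 0 1 (k + 2) := by
    rintro (_ | k)
    · simp
    · simp only [Nat.add_sub_cancel, hZ1 0 0, hZ2 1 0, neg_neg]
  have z30 : ∀ k : ℕ, (k : ℝ) • Z 3 0 (k - 1) = -((k : ℝ) • Z 1 1 (k + 1)) := by
    rintro (_ | k)
    · simp
    · simp only [Nat.add_sub_cancel, hZ1 1 0, smul_neg]
  have z03 : ∀ k : ℕ, (k : ℝ) • Z 0 3 (k - 1) = -((k : ℝ) • Z 1 1 k) := by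
    rintro (_ | k)
    · simp
    · simp only [Nat.add_sub_cancel, hZ2 0 1, smul_neg]
  have z31 : ∀ k : ℕ, (k : ℝ) • Z 3 1 (k - 1) = -((k : ℝ) • Z 0 1 (k + 4)) := by
    rintro (_ | k)
    · simp
    · simp only [Nat.add_sub_cancel, hZ1 1 1, hZ2 1 0, hZ1 0 0, smul_neg, neg_neg]
  have z13 : ∀ k : ℕ, (k : ℝ) • Z 1 3 (k - 1) = -((k : ℝ) • Z 1 0 (k + 3)) := by
    rintro (_ | k)
    · simp
    · simp only [Nat.add_sub_cancel, hZ2 1 1, hZ1 0 1, hZ2 0 0, smul_neg, neg_neg]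
  -- the relations `h i j k` solved for `X` and `Y` in terms of `Z` (and of `Y 1 0 k`)
  have r00 : ∀ k, Z 0 0 k = 0 := fun k => by
    have := h 0 0 (k + 1)
    have hk : ((k : ℝ) + 1) ≠ 0 := by positivity
    simpa [hk] using this
  have r10 : ∀ k : ℕ, X 0 0 k = -(k : ℝ) • Z 1 0 (k - 1) := fun k => by
    have := h 1 0 k
    simp at this
    linear_combination (norm := module) (1 : ℝ) • this
  have r01 : ∀ k : ℕ, Y 0 0 k = -(k : ℝ) • Z 0 1 (k - 1) := fun k => by
    have := h 0 1 k
    simp at this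
    linear_combination (norm := module) (1 : ℝ) • this
  have r11 : ∀ k : ℕ, X 0 1 k = -Y 1 0 k - (k : ℝ) • Z 1 1 (k - 1) := fun k => by
    have := h 1 1 k
    simp at this
    linear_combination (norm := module) (1 : ℝ) • this
  have r20 : ∀ k : ℕ, X 1 0 k = ((k : ℝ) / 2) • Z 0 1 (k + 1) := fun k => by
    have := h 2 0 k
    rw [z20] at this
    simp at this
    linear_combination (norm := module) (1 / 2 : ℝ) • this
  have r02 : ∀ k : ℕ, Y 0 1 k = ((k : ℝ) / 2) • Z 1 0 k := fun k => by
    have := h 0 2 k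
    rw [z02] at this
    simp at this
    linear_combination (norm := module) (1 / 2 : ℝ) • this
  have r21 : ∀ k : ℕ, X 1 1 k = ((2 - k : ℝ) / 4) • Z 1 0 (k + 2) := fun k => by
    have := h 2 1 k
    rw [z21, hY1 0 0 k, r02] at this
    simp at this
    linear_combination (norm := module) (1 / 2 : ℝ) • this
  have r12 : ∀ k : ℕ, Y 1 1 k = ((1 - k : ℝ) / 4) • Z 0 1 (k + 2) := fun k => by
    have := h 1 2 k
    rw [z12, Nat.sub_self, hX2 0 0 k, r20] at this
    simp at this
    linear_combination (norm := module) (1 / 2 : ℝ) • this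
  have r30 : ∀ k : ℕ, X 0 1 (k + 2) = -((k : ℝ) / 3) • Z 1 1 (k + 1) := fun k => by
    have := h 3 0 k
    rw [z30, show 3 - 1 = 0 + 2 from rfl, hX1] at this
    simp at this
    linear_combination (norm := module) (-1 / 3 : ℝ) • this
  have r03 : ∀ k : ℕ, Y 1 0 (k + 1) = -((k : ℝ) / 3) • Z 1 1 k := fun k => by
    have := h 0 3 k
    rw [z03, show 3 - 1 = 0 + 2 from rfl, hY2] at this
    simp at this
    linear_combination (norm := module) (-1 / 3 : ℝ) • this
  -- a second expression for the same class makes almost all of the `Z i j k` vanish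
  have e0 : ∀ k, Z 1 1 (k + 1) = 0 := fun k => by
    have h1 := r11 (k + 2)
    rw [r30, r03 (k + 1)] at h1
    simp at h1
    have : (((k : ℝ) + 5) / 3) • Z 1 1 (k + 1) = 0 := by
      linear_combination (norm := module) (1 : ℝ) • h1
    have hk : ((k : ℝ) + 5) / 3 ≠ 0 := by positivity
    exact (smul_eq_zero.1 this).resolve_left hk
  have b0 : ∀ k, Z 0 1 (k + 4) = 0 := fun k => by
    have h1 := h 3 1 k
    rw [z31, show 3 - 1 = 0 + 2 from rfl, hX1, hX2, r20, show 1 - 1 = 0 from rfl, hY1 1 0,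
      r12] at h1
    simp at h1
    have : ((3 * (k : ℝ) + 19) / 4) • Z 0 1 (k + 4) = 0 := by
      linear_combination (norm := module) (1 : ℝ) • h1
    have hk : (3 * (k : ℝ) + 19) / 4 ≠ 0 := by positivity
    exact (smul_eq_zero.1 this).resolve_left hk
  have a0 : ∀ k, Z 1 0 (k + 3) = 0 := fun k => by
    have h1 := h 1 3 k
    rw [z13, show 3 - 1 = 0 + 2 from rfl, hY2, hY1 0 0, r02, show 1 - 1 = 0 from rfl, hX2 0 1,
      r21] at h1
    simp at h1
    have : ((3 * (k : ℝ) + 17) / 4) • Z 1 0 (k + 3) = 0 := by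
      linear_combination (norm := module) (1 : ℝ) • h1
    have hk : (3 * (k : ℝ) + 17) / 4 ≠ 0 := by positivity
    exact (smul_eq_zero.1 this).resolve_left hk
  have uZ01 : ∀ k, Z 0 1 k ∈ U := fun k => by
    by_cases hk : k < 4
    · exact hb k hk
    · obtain ⟨l, rfl⟩ := Nat.exists_eq_add_of_le' (not_lt.1 hk)
      rw [b0]; exact U.zero_mem
  have uZ10 : ∀ k, Z 1 0 k ∈ U := fun k => by
    by_cases hk : k < 3
    · exact ha k hk
    · obtain ⟨l, rfl⟩ := Nat.exists_eq_add_of_le' (not_lt.1 hk)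
      rw [a0]; exact U.zero_mem
  have uZ11 : ∀ k, Z 1 1 k ∈ U := fun k => by
    cases k with
    | zero => exact he
    | succ k => rw [e0]; exact U.zero_mem
  have uY10 : ∀ k, Y 1 0 k ∈ U := fun k => by
    cases k with
    | zero => exact hu
    | succ k => rw [r03]; exact U.smul_mem _ (uZ11 _)
  refine ⟨mem_of_reduction hX1 hX2 (fun k => ?_) (fun k => ?_) (fun k => ?_) (fun k => ?_) i j k,
    mem_of_reduction hY1 hY2 (fun k => ?_) uY10 (fun k => ?_) (fun k => ?_) i j k,
    mem_of_reduction hZ1 hZ2 (fun k => ?_) uZ10 uZ01 uZ11 i j k⟩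
  · rw [r10]; exact U.smul_mem _ (uZ10 _)
  · rw [r20]; exact U.smul_mem _ (uZ01 _)
  · rw [r11]; exact U.sub_mem (U.neg_mem (uY10 _)) (U.smul_mem _ (uZ11 _))
  · rw [r21]; exact U.smul_mem _ (uZ10 _)
  · rw [r01]; exact U.smul_mem _ (uZ01 _)
  · rw [r02]; exact U.smul_mem _ (uZ10 _)
  · rw [r12]; exact U.smul_mem _ (uZ01 _)
  · rw [r00]; exact U.zero_mem

/-! ### Weighted Taylor expansions -/

/-- The monomial `x^i y^j z^k` with exponent `e = (i, j, k)`. -/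
def mono (e : ℕ × ℕ × ℕ) (x : E 3) : ℝ := x 0 ^ e.1 * x 1 ^ e.2.1 * x 2 ^ e.2.2

/-- The quasi-degree of a monomial. -/
def wt (e : ℕ × ℕ × ℕ) : ℕ := 5 * e.1 + 4 * e.2.1 + 3 * e.2.2

theorem mono_smooth (e : ℕ × ℕ × ℕ) : ContDiff ℝ ∞ (mono e) := by
  unfold mono; fun_prop

theorem mono_dil (e : ℕ × ℕ × ℕ) (t : ℝ) (x : E 3) : mono e (dil t x) = t ^ wt e * mono e x := by
  simp only [mono, dil_apply, wt3, wt, Matrix.cons_val]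
  ring

theorem mono_add (e e' : ℕ × ℕ × ℕ) (x : E 3) : mono (e + e') x = mono e x * mono e' x := by
  simp only [mono, Prod.fst_add, Prod.snd_add]
  ring

/-- The functions of filtration at least `D`: combinations, with smooth coefficients, of monomials
of quasi-degree at least `D`. -/
def Hi (D : ℕ) : Submodule ℝ (E 3 → ℝ) :=
  Submodule.span ℝ {f | ∃ (e : ℕ × ℕ × ℕ) (h : E 3 → ℝ), D ≤ wt e ∧ ContDiff ℝ ∞ h ∧
    f = fun x => mono e x * h x}

theorem mono_mul_mem_Hi {D : ℕ} {e : ℕ × ℕ × ℕ} (he : D ≤ wt e) {h : E 3 → ℝ}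
    (hh : ContDiff ℝ ∞ h) : (fun x => mono e x * h x) ∈ Hi D :=
  Submodule.subset_span ⟨e, h, he, hh, rfl⟩

theorem Hi_mono {D D' : ℕ} (h : D ≤ D') : Hi D' ≤ Hi D :=
  Submodule.span_mono fun _ ⟨e, f, he, hf, hfe⟩ => ⟨e, f, h.trans he, hf, hfe⟩

theorem Hi_smooth {D : ℕ} {f : E 3 → ℝ} (hf : f ∈ Hi D) : ContDiff ℝ ∞ f := by
  induction hf using Submodule.span_induction with
  | mem f hf => obtain ⟨e, h, -, hh, rfl⟩ := hf; exact (mono_smooth e).mul hh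
  | zero => exact contDiff_const
  | add f g _ _ hf hg => exact hf.add hg
  | smul c f _ hf => exact contDiff_const.mul hf

/-- Along the orbit of a point under the dilations, a function of filtration at least `D` is
divisible by `t ^ D`. -/
theorem Hi_dil {D : ℕ} {f : E 3 → ℝ} (hf : f ∈ Hi D) (x : E 3) :
    ∃ H : ℝ → ℝ, Continuous H ∧ ∀ t, f (dil t x) = t ^ D * H t := by
  induction hf using Submodule.span_induction with
  | mem f hf =>
    obtain ⟨e, h, he, hh, rfl⟩ := hf
    refine ⟨fun t => t ^ (wt e - D) * mono e x * h (dil t x), ?_, fun t => ?_⟩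
    · have : Continuous fun t => dil t x :=
        contDiff_dil.continuous.comp (Continuous.prodMk_right x)
      have := hh.continuous.comp this
      fun_prop
    · obtain ⟨k, hk⟩ := Nat.exists_eq_add_of_le he
      simp only [mono_dil]
      rw [hk, Nat.add_sub_cancel_left, pow_add]
      ring
  | zero => exact ⟨0, continuous_const, fun t => by simp⟩
  | add f g _ _ hf hg =>
    obtain ⟨H, hH, h⟩ := hf
    obtain ⟨H', hH', h'⟩ := hg
    exact ⟨fun t => H t + H' t, hH.add hH', fun t => by rw [Pi.add_apply, h, h']; ring⟩
  | smul c f _ hf =>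
    obtain ⟨H, hH, h⟩ := hf
    exact ⟨fun t => c * H t, hH.const_mul c, fun t => by
      rw [Pi.smul_apply, h, smul_eq_mul]; ring⟩

/-- The exponents of quasi-degree less than `D`. -/
def expo (D : ℕ) : Finset (ℕ × ℕ × ℕ) :=
  (Finset.range (D / 5 + 1) ×ˢ Finset.range (D / 4 + 1) ×ˢ Finset.range (D / 3 + 1)).filter
    fun e => wt e < D

theorem mem_expo {D : ℕ} {e : ℕ × ℕ × ℕ} : e ∈ expo D ↔ wt e < D := by
  rw [expo, Finset.mem_filter]
  simp only [Finset.mem_product, Finset.mem_range, wt]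
  omega

/-- `c` gives the weighted Taylor coefficients of `g` in quasi-degrees less than `D`; its values
at the other exponents are arbitrary. -/
def Jet (D : ℕ) (g : E 3 → ℝ) (c : ℕ × ℕ × ℕ → ℝ) : Prop :=
  (fun x => g x - ∑ e ∈ expo D, c e * mono e x) ∈ Hi D

namespace Jet

variable {D : ℕ} {g g' : E 3 → ℝ} {c c' : ℕ × ℕ × ℕ → ℝ}

theorem congr (h : Jet D g c) (hc : ∀ e, wt e < D → c e = c' e) : Jet D g c' := by
  have : ∀ x, ∑ e ∈ expo D, c e * mono e x = ∑ e ∈ expo D, c' e * mono e x := fun x =>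
    Finset.sum_congr rfl fun e he => by rw [hc e (mem_expo.1 he)]
  simpa only [Jet, this] using h

theorem add (h : Jet D g c) (h' : Jet D g' c') :
    Jet D (fun x => g x + g' x) fun e => c e + c' e := by
  have := (Hi D).add_mem h h'
  unfold Jet
  convert this using 1
  ext x
  simp only [Pi.add_apply, add_mul, Finset.sum_add_distrib]
  ring

theorem smul (a : ℝ) (h : Jet D g c) : Jet D (fun x => a * g x) fun e => a * c e := by
  have := (Hi D).smul_mem a h
  unfold Jet
  convert this using 1
  ext x
  simp only [Pi.smul_apply, smul_eq_mul, mul_sub, Finset.mul_sum, mul_assoc]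

theorem sub (h : Jet D g c) (h' : Jet D g' c') :
    Jet D (fun x => g x - g' x) fun e => c e - c' e := by
  have := h.add (h'.smul (-1))
  simpa only [neg_one_mul, ← sub_eq_add_neg] using this

theorem of_mem_Hi (h : g ∈ Hi D) : Jet D g fun _ => 0 := by
  simpa [Jet] using h

theorem monomial (D : ℕ) (e : ℕ × ℕ × ℕ) : Jet D (mono e) fun e' => if e' = e then 1 else 0 := by
  unfold Jet
  by_cases he : wt e < D
  · have : (fun x => mono e x - ∑ e' ∈ expo D, (if e' = e then 1 else 0) * mono e' x) = 0 := by
      ext x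
      simp [mem_expo, he]
    rw [this]
    exact (Hi D).zero_mem
  · have : (fun x => mono e x - ∑ e' ∈ expo D, (if e' = e then 1 else 0) * mono e' x) =
        fun x => mono e x * 1 := by
      ext x
      simp [mem_expo, he]
    rw [this]
    exact mono_mul_mem_Hi (not_lt.1 he) contDiff_const

theorem sum {ι : Type*} (s : Finset ι) {G : ι → E 3 → ℝ} {C : ι → ℕ × ℕ × ℕ → ℝ}
    (h : ∀ i ∈ s, Jet D (G i) (C i)) :
    Jet D (fun x => ∑ i ∈ s, G i x) fun e => ∑ i ∈ s, C i e := by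
  classical
  have h0 : Jet D (fun _ => 0) fun _ => 0 := of_mem_Hi (Hi D).zero_mem
  induction s using Finset.induction_on with
  | empty => simpa only [Finset.sum_empty] using h0
  | insert i s hi ih =>
    simp only [Finset.sum_insert hi]
    exact (h i (Finset.mem_insert_self i s)).add
      (ih fun j hj => h j (Finset.mem_insert_of_mem hj))

/-- Hadamard's lemma for the coefficients of the monomials gains one quasi-degree, since every
coordinate has weight at least `1`. -/
theorem exists_of_mem_Hi (h : g ∈ Hi D) : ∃ c, Jet (D + 1) g c := by
  induction h using Submodule.span_induction with
  | mem f hf =>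
    obtain ⟨e, h, he, hh, rfl⟩ := hf
    obtain ⟨k, hk, hhk⟩ := hadamard hh
    have m : ∀ (u : ℕ × ℕ × ℕ) (i : Fin 3), 1 ≤ wt u →
        (fun x => mono (e + u) x * k i x) ∈ Hi (D + 1) := fun u i hu =>
      mono_mul_mem_Hi (by simp only [wt, Prod.fst_add, Prod.snd_add] at *; omega) (hk i)
    have h1 := (((Jet.monomial (D + 1) e).smul (h 0)).add (of_mem_Hi (m (1, 0, 0) 0 (by decide))))
      |>.add (of_mem_Hi (m (0, 1, 0) 1 (by decide)))
      |>.add (of_mem_Hi (m (0, 0, 1) 2 (by decide)))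
    have e1 : (fun x => mono e x * h x) = fun x => h 0 * mono e x +
        mono (e + (1, 0, 0)) x * k 0 x + mono (e + (0, 1, 0)) x * k 1 x +
        mono (e + (0, 0, 1)) x * k 2 x := by
      ext x
      rw [hhk x]
      simp only [mono_add]
      simp only [mono]
      ring
    rw [e1]
    exact ⟨_, h1⟩
  | zero => exact ⟨_, of_mem_Hi (Hi (D + 1)).zero_mem⟩
  | add f g _ _ hf hg =>
    obtain ⟨c, h⟩ := hf
    obtain ⟨c', h'⟩ := hg
    exact ⟨_, h.add h'⟩
  | smul a f _ hf =>
    obtain ⟨c, h⟩ := hf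
    exact ⟨_, h.smul a⟩

/-- Taylor's theorem. -/
theorem exists_of_smooth (hg : ContDiff ℝ ∞ g) (D : ℕ) : ∃ c, Jet D g c := by
  induction D with
  | zero =>
    refine ⟨fun _ => 0, of_mem_Hi ?_⟩
    have := mono_mul_mem_Hi (D := 0) (e := 0) (Nat.zero_le _) hg
    simpa [mono] using this
  | succ D ih =>
    obtain ⟨c, h⟩ := ih
    obtain ⟨c', h'⟩ := exists_of_mem_Hi h
    have h1 := h'.add (sum (expo D) fun e _ => (monomial (D + 1) e).smul (c e))
    simp only [sub_add_cancel] at h1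
    exact ⟨_, h1⟩

end Jet

/-- A polynomial of degree less than `D` that is `O(t ^ D)` as `t → 0+` is zero. -/
theorem coeff_eq_zero_of_eventually (D : ℕ) : ∀ {a : ℕ → ℝ} {H : ℝ → ℝ} (_ : Continuous H)
    (_ : ∀ᶠ t in 𝓝[>] (0 : ℝ), ∑ d ∈ Finset.range D, a d * t ^ d = t ^ D * H t),
    ∀ d < D, a d = 0 := by
  induction D with
  | zero => intro a H _ _ d hd; omega
  | succ D ih =>
    intro a H hH h
    have h0 : a 0 = 0 := by
      have l1 : Tendsto (fun t : ℝ => ∑ d ∈ Finset.range (D + 1), a d * t ^ d) (𝓝[>] 0)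
          (𝓝 (∑ d ∈ Finset.range (D + 1), a d * 0 ^ d)) := by
        have : Continuous fun t : ℝ => ∑ d ∈ Finset.range (D + 1), a d * t ^ d := by fun_prop
        exact (this.tendsto 0).mono_left nhdsWithin_le_nhds
      have l2 : Tendsto (fun t : ℝ => t ^ (D + 1) * H t) (𝓝[>] 0) (𝓝 (0 ^ (D + 1) * H 0)) := by
        have : Continuous fun t : ℝ => t ^ (D + 1) * H t := by fun_prop
        exact (this.tendsto 0).mono_left nhdsWithin_le_nhds
      have := tendsto_nhds_unique (l1.congr' h) l2
      simpa [Finset.sum_range_succ'] using this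
    have h1 : ∀ d < D, a (d + 1) = 0 := by
      refine ih hH ?_
      filter_upwards [h, self_mem_nhdsWithin] with t ht ht0
      rw [Finset.sum_range_succ', h0] at ht
      have ht0' : t ≠ 0 := ne_of_gt ht0
      refine mul_left_cancel₀ ht0' ?_
      rw [Finset.mul_sum]
      calc _ = ∑ d ∈ Finset.range D, a (d + 1) * t ^ (d + 1) :=
            Finset.sum_congr rfl fun d _ => by ring
        _ = _ := by linear_combination ht
    rintro (_ | d) hd
    · exact h0
    · exact h1 d (by omega)

/-- The quasi-homogeneous parts of the Taylor expansion of a function vanish at every point whose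
orbit under the dilations lies, near `0`, in the zero set of the function. -/
theorem Jet.homogeneous_eq_zero {D : ℕ} {g : E 3 → ℝ} {c : ℕ × ℕ × ℕ → ℝ} (h : Jet D g c) (x : E 3)
    (hx : ∀ᶠ t in 𝓝[>] (0 : ℝ), g (dil t x) = 0) {d : ℕ} (hd : d < D) :
    ∑ e ∈ (expo D).filter (fun e => wt e = d), c e * mono e x = 0 := by
  obtain ⟨H, hH, hHt⟩ := Hi_dil h x
  refine coeff_eq_zero_of_eventually D
    (a := fun d => ∑ e ∈ (expo D).filter (fun e => wt e = d), c e * mono e x)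
    (H := fun t => -H t) hH.neg ?_ d hd
  filter_upwards [hx] with t ht
  have h1 := hHt t
  rw [ht] at h1
  simp only [mono_dil] at h1
  have h2 : ∑ d ∈ Finset.range D, (∑ e ∈ (expo D).filter (fun e => wt e = d), c e * mono e x) *
      t ^ d = ∑ e ∈ expo D, c e * (t ^ wt e * mono e x) := by
    rw [← Finset.sum_fiberwise_of_maps_to (s := expo D) (t := Finset.range D) (g := wt)
      (fun e he => Finset.mem_range.2 (mem_expo.1 he))]
    refine Finset.sum_congr rfl fun d _ => ?_
    rw [Finset.sum_mul]
    refine Finset.sum_congr rfl fun e he => ?_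
    rw [(Finset.mem_filter.1 he).2]
    ring
  rw [h2]
  linarith

/-- Distinct monomials are linearly independent as functions. -/
theorem coeff_eq_zero_of_forall (s : Finset (ℕ × ℕ × ℕ)) (c : ℕ × ℕ × ℕ → ℝ)
    (h : ∀ x, ∑ e ∈ s, c e * mono e x = 0) : ∀ e ∈ s, c e = 0 := by
  classical
  let φ : ℕ × ℕ × ℕ → (Fin 3 →₀ ℕ) := fun e => Finsupp.equivFunOnFinite.symm ![e.1, e.2.1, e.2.2]
  have φ_inj : Function.Injective φ := by
    rintro ⟨a, b, c⟩ ⟨a', b', c'⟩ hab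
    have := Finsupp.equivFunOnFinite.symm.injective hab
    simpa using this
  have hP : ∑ e ∈ s, MvPolynomial.monomial (φ e) (c e) = 0 := by
    refine MvPolynomial.funext fun x => ?_
    rw [map_sum, map_zero, ← h x]
    refine Finset.sum_congr rfl fun e _ => ?_
    rw [MvPolynomial.eval_monomial, Finsupp.prod_fintype _ _ (fun i => pow_zero _)]
    simp [φ, mono, Fin.prod_univ_three]
  intro e he
  have := congrArg (MvPolynomial.coeff (φ e)) hP
  rw [MvPolynomial.coeff_sum, MvPolynomial.coeff_zero] at this
  simpa [MvPolynomial.coeff_monomial, φ_inj.eq_iff, he] using this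

theorem tendsto_dil (x : E 3) : Tendsto (fun t => dil t x) (𝓝[>] 0) (𝓝 0) := by
  have h : Continuous fun t => dil t x := contDiff_dil.continuous.comp (Continuous.prodMk_right x)
  have := h.tendsto 0
  rw [dil_zero] at this
  exact this.mono_left nhdsWithin_le_nhds

theorem Jet.eq_zero {D : ℕ} {g : E 3 → ℝ} {c : ℕ × ℕ × ℕ → ℝ} (h : Jet D g c)
    (hg : g =ᶠ[𝓝 0] 0) {e : ℕ × ℕ × ℕ} (he : wt e < D) : c e = 0 := by
  refine coeff_eq_zero_of_forall ((expo D).filter fun e' => wt e' = wt e) c (fun x => ?_) e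
    (Finset.mem_filter.2 ⟨mem_expo.2 he, rfl⟩)
  exact h.homogeneous_eq_zero x ((tendsto_dil x).eventually hg) he

theorem Jet.unique {D : ℕ} {g g' : E 3 → ℝ} {c c' : ℕ × ℕ × ℕ → ℝ} (h : Jet D g c)
    (h' : Jet D g' c') (hg : g =ᶠ[𝓝 0] g') {e : ℕ × ℕ × ℕ} (he : wt e < D) : c e = c' e := by
  refine sub_eq_zero.1 ((h.sub h').eq_zero ?_ he)
  filter_upwards [hg] with x hx
  simp [hx]

/-! ### Taylor expansions of partial derivatives -/

/-- The exponent of the coordinate `x_i`. -/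
def unitExp : Fin 3 → ℕ × ℕ × ℕ := ![(1, 0, 0), (0, 1, 0), (0, 0, 1)]

/-- The degree of a monomial in the coordinate `x_i`. -/
def degIn (i : Fin 3) (e : ℕ × ℕ × ℕ) : ℕ := ![e.1, e.2.1, e.2.2] i

/-- If `x_i` does not occur in the monomial, the exponent on the right is truncated, but its factor
`degIn i e` is zero. -/
theorem pd_mono (i : Fin 3) (e : ℕ × ℕ × ℕ) (x : E 3) :
    pd i (mono e) x = degIn i e * mono (e - unitExp i) x := by
  have s0 := coord_smooth 0
  have s1 := coord_smooth 1
  have s2 := coord_smooth 2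
  have : mono e = fun x => x 0 ^ e.1 * x 1 ^ e.2.1 * x 2 ^ e.2.2 := rfl
  rw [this, pd_mul ((s0.pow _).mul (s1.pow _)) (s2.pow _), pd_mul (s0.pow _) (s1.pow _),
    pd_pow s0, pd_pow s1, pd_pow s2, pd_coord, pd_coord, pd_coord]
  fin_cases i <;> simp [degIn, unitExp, mono] <;> ring

theorem pd_mem_Hi {D : ℕ} {f : E 3 → ℝ} (hf : f ∈ Hi D) (i : Fin 3) :
    pd i f ∈ Hi (D - wt3 i) := by
  induction hf using Submodule.span_induction with
  | mem f hf =>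
    obtain ⟨e, h, he, hh, rfl⟩ := hf
    have e1 : pd i (fun x => mono e x * h x) = (fun x => mono (e - unitExp i) x *
        (degIn i e * h x)) + fun x => mono e x * pd i h x := by
      ext x
      rw [pd_mul (mono_smooth e) hh, pd_mono, Pi.add_apply]
      ring
    rw [e1]
    refine Submodule.add_mem _ (mono_mul_mem_Hi ?_ (contDiff_const.mul hh))
      (mono_mul_mem_Hi ((Nat.sub_le _ _).trans he) (hh.pd i))
    refine (Nat.sub_le_sub_right he _).trans ?_
    fin_cases i <;> simp [wt, wt3, unitExp] <;> omega
  | zero =>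
    have : pd i (0 : E 3 → ℝ) = 0 := by ext x; exact pd_const 0 i x
    rw [this]; exact Submodule.zero_mem _
  | add f g hf' hg' hf hg =>
    have : pd i (f + g) = pd i f + pd i g := by
      ext x; exact pd_add (Hi_smooth hf') (Hi_smooth hg') i x
    rw [this]; exact Submodule.add_mem _ hf hg
  | smul a f hf' hf =>
    have : pd i (a • f) = a • pd i f := by
      ext x; exact pd_const_mul a (Hi_smooth hf') i x
    rw [this]; exact Submodule.smul_mem _ a hf

theorem pd_sum {ι : Type*} (s : Finset ι) {f : ι → E 3 → ℝ} (hf : ∀ j, ContDiff ℝ ∞ (f j))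
    (i : Fin 3) (x : E 3) : pd i (fun y => ∑ j ∈ s, f j y) x = ∑ j ∈ s, pd i (f j) x := by
  simp only [pd]
  rw [fderiv_fun_sum fun j _ => (hf j).diffAt x]
  simp

theorem Jet.pd {D : ℕ} {g : E 3 → ℝ} {c : ℕ × ℕ × ℕ → ℝ} (h : Jet D g c) (hg : ContDiff ℝ ∞ g)
    (i : Fin 3) :
    Jet (D - wt3 i) (pd i g) fun e => (degIn i e + 1) * c (e + unitExp i) := by
  have sm : ∀ e, ContDiff ℝ ∞ fun x => c e * mono e x := fun e =>
    contDiff_const.mul (mono_smooth e)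
  have h1 := (Jet.of_mem_Hi (pd_mem_Hi h i)).add
    (Jet.sum (expo D) fun e _ =>
      ((Jet.monomial (D - wt3 i) (e - unitExp i)).smul (degIn i e)).smul (c e))
  have e1 : AlgRestr.pd i g = fun x => AlgRestr.pd i (fun x => g x - ∑ e ∈ expo D, c e * mono e x) x
      + ∑ e ∈ expo D, c e * (degIn i e * mono (e - unitExp i) x) := by
    ext x
    rw [pd_sub hg (ContDiff.sum fun e _ => sm e), pd_sum _ sm]
    simp only [pd_const_mul _ (mono_smooth _), pd_mono]
    ring
  rw [e1]
  refine h1.congr fun e he => ?_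
  rw [Finset.sum_eq_single (e + unitExp i)]
  · have e2 : e + unitExp i - unitExp i = e := by
      ext <;> simp
    have e3 : degIn i (e + unitExp i) = degIn i e + 1 := by
      fin_cases i <;> simp [degIn, unitExp]
    rw [e2, e3]
    push_cast
    simp
    ring
  · intro e' _ hne
    by_cases h0 : degIn i e' = 0
    · simp [h0]
    · have : e ≠ e' - unitExp i := by
        rintro rfl
        apply hne
        fin_cases i <;> simp [degIn, unitExp] at * <;> ext <;> simp <;> omega
      simp [this]
  · intro hne
    exfalso
    apply hne
    rw [mem_expo]
    fin_cases i <;> simp [wt, wt3, unitExp] at * <;> omega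

/-! ### Generators of the algebraic restrictions in `ℝ³` -/

theorem _root_.ContDiff.smoothNearZero {m p : ℕ} {η : Form m p} (h : ContDiff ℝ ∞ η) :
    SmoothNearZero η :=
  Eventually.of_forall fun _ => h.contDiffAt

theorem germ_congr {m p : ℕ} {η η' : Form m p} {h : SmoothNearZero η} {h' : SmoothNearZero η'}
    (e : η =ᶠ[𝓝 0] η') : germ η h = germ η' h' :=
  Subtype.ext (toGerm_eq.2 e)

theorem germ_mem_LamVanish {m p : ℕ} {N : Set (E m)} {η : Form m p} (h : SmoothNearZero η)
    (hv : ∀ x ∈ N, η x = 0) : germ η h ∈ LamVanish N p :=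
  ⟨η, rfl, Eventually.of_forall hv⟩

theorem restr_d_eq_zero {m : ℕ} {N : Set (E m)} {g : Lam m 1} (hg : g ∈ LamVanish N 1) :
    restr N (d m 1 g) = 0 :=
  (Submodule.Quotient.mk_eq_zero _).2
    (Submodule.mem_sup_right (Submodule.mem_map_of_mem hg))

/-- Smooth functions on `ℝ³`. -/
def Sm : Submodule ℝ (E 3 → ℝ) where
  carrier := {f | ContDiff ℝ ∞ f}
  add_mem' {f g} (hf : ContDiff ℝ ∞ f) (hg : ContDiff ℝ ∞ g) := hf.add hg
  zero_mem' := show ContDiff ℝ ∞ fun _ : E 3 => (0 : ℝ) from contDiff_const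
  smul_mem' _ f (hf : ContDiff ℝ ∞ f) := contDiff_const.mul hf

theorem Sm_smooth (f : Sm) : ContDiff ℝ ∞ (f : E 3 → ℝ) := f.2

theorem smul_dx_contDiff (i : Fin 3) (f : Sm) :
    ContDiff ℝ ∞ fun x => (f : E 3 → ℝ) x • (dx i : (E 3) [⋀^Fin 1]→L[ℝ] ℝ) :=
  (Sm_smooth f).smul contDiff_const

/-- The germ of `f dx_i`. -/
def smulDx (i : Fin 3) : Sm →ₗ[ℝ] Lam 3 1 where
  toFun f := germ (fun x => (f : E 3 → ℝ) x • dx i) (smul_dx_contDiff i f).smoothNearZero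
  map_add' f g := Subtype.ext (toGerm_eq.2 (Eventually.of_forall fun x => by simp [add_smul]))
  map_smul' c f := Subtype.ext (toGerm_eq.2 (Eventually.of_forall fun x => by simp [mul_smul]))

/-- The algebraic restriction to `W3` of `df ∧ dx_i`. -/
def K (i : Fin 3) : Sm →ₗ[ℝ] Restr W3 := restr W3 ∘ₗ d 3 1 ∘ₗ smulDx i

theorem K_sum (p q r : Sm) : K 0 p + K 1 q + K 2 r =
    restr W3 (germ (form2 (fun x => pd 1 r x - pd 2 q x) (fun x => pd 0 r x - pd 2 p x)
      (fun x => pd 0 q x - pd 1 p x))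
        (form2_contDiff (((Sm_smooth r).pd 1).sub ((Sm_smooth q).pd 2))
          (((Sm_smooth r).pd 0).sub ((Sm_smooth p).pd 2))
          (((Sm_smooth q).pd 0).sub ((Sm_smooth p).pd 1))).smoothNearZero) := by
  simp only [K, LinearMap.comp_apply, ← map_add]
  have h : smulDx 0 p + smulDx 1 q + smulDx 2 r =
      germ (form1 p q r)
        (form1_contDiff (Sm_smooth p) (Sm_smooth q) (Sm_smooth r)).smoothNearZero := rfl
  rw [h, d_germ]
  exact congrArg _ (germ_congr (Eventually.of_forall fun x => by
    rw [extDeriv_form1 (Sm_smooth p) (Sm_smooth q) (Sm_smooth r)]))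

/-- A `1`-form `f dx_i` with `f = 0` on `W3` vanishes on `W3`, so its differential has zero
algebraic restriction. -/
theorem K_eq_zero (i : Fin 3) {f : Sm} (hf : ∀ x ∈ W3, (f : E 3 → ℝ) x = 0) : K i f = 0 :=
  restr_d_eq_zero (germ_mem_LamVanish (smul_dx_contDiff i f).smoothNearZero
    fun x hx => by simp [hf x hx])

theorem K_congr (i : Fin 3) {f g : Sm} (hf : ∀ x ∈ W3, (f : E 3 → ℝ) x = (g : E 3 → ℝ) x) :
    K i f = K i g := by
  rw [← sub_eq_zero, ← map_sub]
  exact K_eq_zero i fun x hx => by simp [hf x hx]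

/-- The class of the differential of the `1`-form `dφ` is zero. -/
theorem K_exact {p q r : Sm} {φ : E 3 → ℝ} (hφ : ContDiff ℝ ∞ φ)
    (hp : (p : E 3 → ℝ) = pd 0 φ) (hq : (q : E 3 → ℝ) = pd 1 φ) (hr : (r : E 3 → ℝ) = pd 2 φ) :
    K 0 p + K 1 q + K 2 r = 0 := by
  have h0 : SmoothNearZero (0 : Form 3 2) := contDiff_const.smoothNearZero
  rw [K_sum, germ_congr (η' := 0) (h' := h0)]
  · exact map_zero _
  · refine Eventually.of_forall fun x => ?_
    rw [hp, hq, hr]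
    simp [form2, pd_comm hφ 1 2 x, pd_comm hφ 0 2 x, pd_comm hφ 0 1 x]

theorem z_pow_mul_smooth (k : ℕ) {f : E 3 → ℝ} (hf : ContDiff ℝ ∞ f) :
    ContDiff ℝ ∞ fun x : E 3 => x 2 ^ k * f x :=
  ((coord_smooth 2).pow k).mul hf

theorem pd_z_pow_mul (k : ℕ) {f : E 3 → ℝ} (hf : ContDiff ℝ ∞ f) (i : Fin 3) (x : E 3) :
    pd i (fun y => y 2 ^ k * f y) x =
      k * x 2 ^ (k - 1) * (if 2 = i then 1 else 0) * f x + x 2 ^ k * pd i f x := by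
  rw [pd_mul ((coord_smooth 2).pow k) hf, pd_pow (coord_smooth 2), pd_coord]

theorem div_curl {p q r : E 3 → ℝ} (hp : ContDiff ℝ ∞ p) (hq : ContDiff ℝ ∞ q)
    (hr : ContDiff ℝ ∞ r) (x : E 3) :
    pd 0 (fun x => pd 1 r x - pd 2 q x) x - pd 1 (fun x => pd 0 r x - pd 2 p x) x +
      pd 2 (fun x => pd 0 q x - pd 1 p x) x = 0 := by
  rw [pd_sub (hr.pd 1) (hq.pd 2), pd_sub (hr.pd 0) (hp.pd 2), pd_sub (hq.pd 0) (hp.pd 1),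
    pd_comm hr 1 0, pd_comm hq 2 0, pd_comm hp 2 1]
  ring

/-- Sufficiently flat `1`-forms have differentials with zero algebraic restriction: such a
differential has another primitive, which annihilates the Euler field. -/
theorem K_flat {p q r : E 3 → ℝ} (hp : ContDiff ℝ ∞ p) (hq : ContDiff ℝ ∞ q)
    (hr : ContDiff ℝ ∞ r) :
    K 0 ⟨_, z_pow_mul_smooth 7 hp⟩ + K 1 ⟨_, z_pow_mul_smooth 7 hq⟩ +
      K 2 ⟨_, z_pow_mul_smooth 7 hr⟩ = 0 := by
  have zp := z_pow_mul_smooth 7 hp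
  have zq := z_pow_mul_smooth 7 hq
  have zr := z_pow_mul_smooth 7 hr
  have hp1 := hp.pd 1
  have hp2 := hp.pd 2
  have hq0 := hq.pd 0
  have hq2 := hq.pd 2
  have hr0 := hr.pd 0
  have hr1 := hr.pd 1
  set A : E 3 → ℝ := fun x => x 2 * (pd 1 r x - pd 2 q x) - 7 * q x with hA
  set B : E 3 → ℝ := fun x => x 2 * (pd 0 r x - pd 2 p x) - 7 * p x with hB
  set C : E 3 → ℝ := fun x => x 2 * (pd 0 q x - pd 1 p x) with hC
  have sA : ContDiff ℝ ∞ A := by rw [hA]; fun_prop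
  have sB : ContDiff ℝ ∞ B := by rw [hB]; fun_prop
  have sC : ContDiff ℝ ∞ C := by rw [hC]; fun_prop
  have eA : (fun x => pd 1 (fun y => y 2 ^ 7 * r y) x - pd 2 (fun y => y 2 ^ 7 * q y) x) =
      fun y => y 2 ^ 6 * A y := by
    ext x; rw [pd_z_pow_mul 7 hr, pd_z_pow_mul 7 hq]; simp [hA]; ring
  have eB : (fun x => pd 0 (fun y => y 2 ^ 7 * r y) x - pd 2 (fun y => y 2 ^ 7 * p y) x) =
      fun y => y 2 ^ 6 * B y := by
    ext x; rw [pd_z_pow_mul 7 hr, pd_z_pow_mul 7 hp]; simp [hB]; ring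
  have eC : (fun x => pd 0 (fun y => y 2 ^ 7 * q y) x - pd 1 (fun y => y 2 ^ 7 * p y) x) =
      fun y => y 2 ^ 6 * C y := by
    ext x; rw [pd_z_pow_mul 7 hq, pd_z_pow_mul 7 hp]; simp [hC]; ring
  have hdiv := div_curl zp zq zr
  rw [eA, eB, eC] at hdiv
  obtain ⟨P, Q, R, hP, hQ, hR, hE, hcurl⟩ :=
    exists_primitive 6 sA sB sC (ρ := 1) fun x _ => hdiv x
  obtain ⟨φ, hφ, hφW⟩ := exists_vanishing_primitive hP hQ hE
  have h1 : K 0 ⟨_, z_pow_mul_smooth 7 hp⟩ + K 1 ⟨_, z_pow_mul_smooth 7 hq⟩ +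
      K 2 ⟨_, z_pow_mul_smooth 7 hr⟩ = K 0 ⟨_, z_pow_mul_smooth 6 hP⟩ +
      K 1 ⟨_, z_pow_mul_smooth 6 hQ⟩ + K 2 ⟨_, z_pow_mul_smooth 6 hR⟩ := by
    rw [K_sum, K_sum]
    refine congrArg _ (germ_congr ?_)
    filter_upwards [Metric.closedBall_mem_nhds (0 : E 3) one_pos] with x hx
    obtain ⟨c1, c2, c3⟩ := hcurl x (by simpa using hx)
    simp only [form2, c1, c2, c3, congrFun eA x, congrFun eB x, congrFun eC x]
  rw [h1, ← K_exact (p := ⟨_, hφ.pd 0⟩) (q := ⟨_, hφ.pd 1⟩) (r := ⟨_, hφ.pd 2⟩) hφ rfl rfl rfl]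
  congr 1
  · congr 1
    · exact K_congr 0 fun x hx => (hφW x hx).1.symm
    · exact K_congr 1 fun x hx => (hφW x hx).2.1.symm
  · exact K_congr 2 fun x hx => (hφW x hx).2.2.symm

theorem K_flat_single (i : Fin 3) {f : E 3 → ℝ} (hf : ContDiff ℝ ∞ f) :
    K i ⟨_, z_pow_mul_smooth 7 hf⟩ = 0 := by
  have s0 : ContDiff ℝ ∞ (fun _ : E 3 => (0 : ℝ)) := contDiff_const
  have z : ∀ j, K j ⟨_, z_pow_mul_smooth 7 s0⟩ = 0 := fun j => K_eq_zero j fun x _ => by simp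
  fin_cases i
  · have := K_flat hf s0 s0
    simp only [z, add_zero] at this
    exact this
  · have := K_flat s0 hf s0
    simp only [z, add_zero, zero_add] at this
    exact this
  · have := K_flat s0 s0 hf
    simp only [z, add_zero, zero_add] at this
    exact this

/-- The relations `x² = -yz²` and `y² = -xz` preserve the quasi-degree and reduce every monomial to
one with `i, j ≤ 1`; if its quasi-degree `5i + 4j + 3k` is at least `30`, then `k ≥ 7`. -/
theorem mono_eq_on_W3 (n : ℕ) : ∀ e : ℕ × ℕ × ℕ, e.1 + e.2.1 = n → 30 ≤ wt e →
    ∃ g : E 3 → ℝ, ContDiff ℝ ∞ g ∧ ∀ x ∈ W3, mono e x = x 2 ^ 7 * g x := by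
  induction n using Nat.strong_induction_on with
  | _ n ih =>
  rintro ⟨i, j, k⟩ hn he
  simp only [wt] at hn he
  by_cases hi : 2 ≤ i
  · obtain ⟨i, rfl⟩ := Nat.exists_eq_add_of_le' hi
    obtain ⟨g, hg, h⟩ := ih (i + (j + 1)) (by omega) (i, j + 1, k + 2) rfl
      (by simp only [wt]; omega)
    refine ⟨fun x => -g x, hg.neg, fun x hx => ?_⟩
    have := h x hx
    simp only [mono] at this ⊢
    linear_combination x 0 ^ i * x 1 ^ j * x 2 ^ k * hx.1 - this
  by_cases hj : 2 ≤ j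
  · obtain ⟨j, rfl⟩ := Nat.exists_eq_add_of_le' hj
    obtain ⟨g, hg, h⟩ := ih (i + 1 + j) (by omega) (i + 1, j, k + 1) rfl
      (by simp only [wt]; omega)
    refine ⟨fun x => -g x, hg.neg, fun x hx => ?_⟩
    have := h x hx
    simp only [mono] at this ⊢
    linear_combination x 0 ^ i * x 1 ^ j * x 2 ^ k * hx.2 - this
  obtain ⟨k, rfl⟩ : ∃ l, k = l + 7 := ⟨k - 7, by omega⟩
  refine ⟨mono (i, j, k), mono_smooth _, fun x _ => ?_⟩
  simp only [mono]
  ring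

theorem eq_on_W3_of_mem_Hi {f : E 3 → ℝ} (hf : f ∈ Hi 30) :
    ∃ g : E 3 → ℝ, ContDiff ℝ ∞ g ∧ ∀ x ∈ W3, f x = x 2 ^ 7 * g x := by
  induction hf using Submodule.span_induction with
  | mem f hf =>
    obtain ⟨e, h, he, hh, rfl⟩ := hf
    obtain ⟨g, hg, hgx⟩ := mono_eq_on_W3 _ e rfl he
    exact ⟨fun x => g x * h x, hg.mul hh, fun x hx => by simp only [hgx x hx]; ring⟩
  | zero => exact ⟨0, contDiff_const, fun x _ => by simp⟩
  | add f f' _ _ hf hf' =>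
    obtain ⟨g, hg, h⟩ := hf
    obtain ⟨g', hg', h'⟩ := hf'
    exact ⟨fun x => g x + g' x, hg.add hg', fun x hx => by
      rw [Pi.add_apply, h x hx, h' x hx]; ring⟩
  | smul c f _ hf =>
    obtain ⟨g, hg, h⟩ := hf
    exact ⟨fun x => c * g x, contDiff_const.mul hg, fun x hx => by
      rw [Pi.smul_apply, h x hx, smul_eq_mul]; ring⟩

/-- The coefficients of `θ_1, …, θ_9` as `2`-forms on `ℝ³`. -/
def thetaCoeff : Fin 9 → Fin 3 → E 3 → ℝ :=
  ![![fun _ => 1, fun _ => 0, fun _ => 0],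
    ![fun _ => 0, fun _ => 1, fun _ => 0],
    ![fun _ => 0, fun _ => 0, fun _ => 1],
    ![fun x => x 2, fun _ => 0, fun _ => 0],
    ![fun _ => 0, fun x => x 2, fun _ => 0],
    ![fun x => x 0, fun x => x 1, fun _ => 0],
    ![fun x => x 2 ^ 2, fun _ => 0, fun _ => 0],
    ![fun _ => 0, fun x => x 2 ^ 2, fun _ => 0],
    ![fun x => x 2 ^ 3, fun _ => 0, fun _ => 0]]

theorem thetaCoeff_smooth (k : Fin 9) (i : Fin 3) : ContDiff ℝ ∞ (thetaCoeff k i) := by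
  fin_cases k <;> fin_cases i <;> simp [thetaCoeff] <;> fun_prop

/-- The forms `θ_1, …, θ_9` on `ℝ³`. -/
def theta3 (k : Fin 9) : Form 3 2 := form2 (thetaCoeff k 0) (thetaCoeff k 1) (thetaCoeff k 2)

theorem theta3_contDiff (k : Fin 9) : ContDiff ℝ ∞ (theta3 k) :=
  form2_contDiff (thetaCoeff_smooth k 0) (thetaCoeff_smooth k 1) (thetaCoeff_smooth k 2)

/-- The germ of `θ_{k+1}` on `ℝ³`. -/
def theta3Germ (k : Fin 9) : Lam 3 2 := germ (theta3 k) (theta3_contDiff k).smoothNearZero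

theorem K_sum_eq_theta (k : Fin 9) {p q r : Sm}
    (h0 : ∀ x, pd 1 r x - pd 2 q x = thetaCoeff k 0 x)
    (h1 : ∀ x, pd 0 r x - pd 2 p x = thetaCoeff k 1 x)
    (h2 : ∀ x, pd 0 q x - pd 1 p x = thetaCoeff k 2 x) :
    K 0 p + K 1 q + K 2 r = restr W3 (theta3Germ k) := by
  rw [K_sum]
  refine congrArg _ (germ_congr (Eventually.of_forall fun x => ?_))
  simp only [theta3, form2, h0, h1, h2]

/-- Monomials as elements of `Sm`. -/
def monoSm (e : ℕ × ℕ × ℕ) : Sm := ⟨mono e, mono_smooth e⟩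

theorem K_mono_mem_span (i : Fin 3) (e : ℕ × ℕ × ℕ) :
    K i (monoSm e) ∈ Submodule.span ℝ (Set.range fun k => restr W3 (theta3Germ k)) := by
  set U := Submodule.span ℝ (Set.range fun k => restr W3 (theta3Germ k)) with hU
  have red1 : ∀ (m : Fin 3) (i j k : ℕ),
      K m (monoSm (i + 2, j, k)) = -K m (monoSm (i, j + 1, k + 2)) := fun m i j k => by
    rw [← map_neg]
    refine K_congr m fun x hx => ?_
    simp only [monoSm, mono, NegMemClass.coe_neg, Pi.neg_apply]
    linear_combination x 0 ^ i * x 1 ^ j * x 2 ^ k * hx.1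
  have red2 : ∀ (m : Fin 3) (i j k : ℕ),
      K m (monoSm (i, j + 2, k)) = -K m (monoSm (i + 1, j, k + 1)) := fun m i j k => by
    rw [← map_neg]
    refine K_congr m fun x hx => ?_
    simp only [monoSm, mono, NegMemClass.coe_neg, Pi.neg_apply]
    linear_combination x 0 ^ i * x 1 ^ j * x 2 ^ k * hx.2
  have rel : ∀ i j k : ℕ, (i : ℝ) • K 0 (monoSm (i - 1, j, k)) +
      (j : ℝ) • K 1 (monoSm (i, j - 1, k)) + (k : ℝ) • K 2 (monoSm (i, j, k - 1)) = 0 := by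
    intro i j k
    simp only [← map_smul]
    refine K_exact (mono_smooth (i, j, k)) ?_ ?_ ?_ <;>
    · ext x
      rw [pd_mono]
      simp [monoSm, degIn, unitExp]
  have hz : ∀ (e : ℕ × ℕ × ℕ) (k : Fin 9), (∀ x, pd 1 (mono e) x = thetaCoeff k 0 x) →
      (∀ x, pd 0 (mono e) x = thetaCoeff k 1 x) → (∀ x, 0 = thetaCoeff k 2 x) →
      K 2 (monoSm e) ∈ U := fun e k h0 h1 h2 => by
    have h : K 0 0 + K 1 0 + K 2 (monoSm e) = restr W3 (theta3Germ k) := by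
      refine K_sum_eq_theta k (fun x => ?_) (fun x => ?_) (fun x => ?_) <;>
        simp only [ZeroMemClass.coe_zero, Pi.zero_def, pd_const, sub_zero]
      exacts [h0 x, h1 x, h2 x]
    simp only [map_zero, zero_add] at h
    rw [h]
    exact Submodule.subset_span ⟨k, rfl⟩
  have hy : K 1 (monoSm (1, 0, 0)) ∈ U := by
    have h : K 0 0 + K 1 (monoSm (1, 0, 0)) + K 2 0 = restr W3 (theta3Germ 2) := by
      refine K_sum_eq_theta 2 (fun x => ?_) (fun x => ?_) (fun x => ?_) <;>
        simp [pd_const, Pi.zero_def, monoSm, pd_mono, thetaCoeff, degIn, unitExp, mono]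
    simp only [map_zero, zero_add, add_zero] at h
    rw [h]
    exact Submodule.subset_span ⟨2, rfl⟩
  have main := mem_of_relations (X := fun i j k => K 0 (monoSm (i, j, k)))
    (Y := fun i j k => K 1 (monoSm (i, j, k))) (Z := fun i j k => K 2 (monoSm (i, j, k)))
    (red1 0) (red2 0) (red1 1) (red2 1) (red1 2) (red2 2) rel (U := U) ?_ ?_ ?_ hy e.1 e.2.1 e.2.2
  · fin_cases i
    exacts [main.1, main.2.1, main.2.2]
  · intro k hk
    interval_cases k
    · refine hz _ 0 ?_ ?_ ?_ <;> simp [pd_mono, thetaCoeff, degIn, unitExp, mono]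
    · refine hz _ 3 ?_ ?_ ?_ <;> simp [pd_mono, thetaCoeff, degIn, unitExp, mono]
    · refine hz _ 6 ?_ ?_ ?_ <;> simp [pd_mono, thetaCoeff, degIn, unitExp, mono]
    · refine hz _ 8 ?_ ?_ ?_ <;> simp [pd_mono, thetaCoeff, degIn, unitExp, mono]
  · intro k hk
    interval_cases k
    · refine hz _ 1 ?_ ?_ ?_ <;> simp [pd_mono, thetaCoeff, degIn, unitExp, mono]
    · refine hz _ 4 ?_ ?_ ?_ <;> simp [pd_mono, thetaCoeff, degIn, unitExp, mono]
    · refine hz _ 7 ?_ ?_ ?_ <;> simp [pd_mono, thetaCoeff, degIn, unitExp, mono]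
  · refine hz _ 5 ?_ ?_ ?_ <;> simp [pd_mono, thetaCoeff, degIn, unitExp, mono]

/-- The Taylor polynomial of `f` up to quasi-degree `30` is treated by the relations among
monomials, and the remainder agrees on `W3` with a multiple of `z⁷`. -/
theorem K_mem_span (i : Fin 3) (f : Sm) :
    K i f ∈ Submodule.span ℝ (Set.range fun k => restr W3 (theta3Germ k)) := by
  obtain ⟨c, hc⟩ := Jet.exists_of_smooth f.2 30
  obtain ⟨g, hg, h⟩ := eq_on_W3_of_mem_Hi hc
  have e : K i f = ∑ e ∈ expo 30, c e • K i (monoSm e) + K i ⟨_, z_pow_mul_smooth 7 hg⟩ := by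
    simp only [← map_smul, ← map_sum, ← map_add]
    refine K_congr i fun x hx => ?_
    have := h x hx
    simp [monoSm] at this ⊢
    linarith
  rw [e, K_flat_single i hg, add_zero]
  exact Submodule.sum_mem _ fun e _ => Submodule.smul_mem _ _ (K_mono_mem_span i e)

/-- The coefficients of the germ of a smooth `2`-form on `ℝ³` extend to smooth functions on `ℝ³`. -/
theorem exists_coefficients {η : Form 3 2} (hη : SmoothNearZero η) : ∃ A B C : E 3 → ℝ,
    ContDiff ℝ ∞ A ∧ ContDiff ℝ ∞ B ∧ ContDiff ℝ ∞ C ∧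
    (fun x => η x ![Pi.single 1 1, Pi.single 2 1]) =ᶠ[𝓝 0] A ∧
    (fun x => η x ![Pi.single 0 1, Pi.single 2 1]) =ᶠ[𝓝 0] B ∧
    (fun x => η x ![Pi.single 0 1, Pi.single 1 1]) =ᶠ[𝓝 0] C := by
  have comp : ∀ v : Fin 2 → E 3, ∃ f : E 3 → ℝ, ContDiff ℝ ∞ f ∧ (fun x => η x v) =ᶠ[𝓝 0] f :=
    fun v => exists_smooth_extension (hη.mono fun x hx =>
      (ContinuousAlternatingMap.apply ℝ (E 3) ℝ v).contDiff.contDiffAt.comp x hx)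
  obtain ⟨A, hA, eA⟩ := comp ![Pi.single 1 1, Pi.single 2 1]
  obtain ⟨B, hB, eB⟩ := comp ![Pi.single 0 1, Pi.single 2 1]
  obtain ⟨C, hC, eC⟩ := comp ![Pi.single 0 1, Pi.single 1 1]
  exact ⟨A, B, C, hA, hB, hC, eA, eB, eC⟩

/-- The nine classes span: near `0` a closed form is `d(p dx + q dy + r dz)`, and each of the
three summands lies in the span. -/
theorem restr_mem_span {g : Lam 3 2} (hg : g ∈ Closed 3) :
    restr W3 g ∈ Submodule.span ℝ (Set.range fun k => restr W3 (theta3Germ k)) := by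
  obtain ⟨_, η, hη, rfl⟩ := g
  obtain ⟨A, B, C, hA, hB, hC, eA, eB, eC⟩ := exists_coefficients hη
  have e : η =ᶠ[𝓝 0] form2 A B C := by
    filter_upwards [eA, eB, eC] with x h0 h1 h2
    rw [twoForm_eq (η x), form2, ← h0, ← h1, ← h2]
  have hcl : extDeriv η =ᶠ[𝓝 0] 0 := toGerm_eq.1 (congrArg Subtype.val (LinearMap.mem_ker.1 hg))
  have hdiv : ∀ᶠ x in 𝓝 (0 : E 3), pd 0 A x - pd 1 B x + pd 2 C x = 0 := by
    filter_upwards [hη, hcl, e.eventually_nhds] with x h1 h2 h3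
    exact divergence_of_extDeriv_eq_zero (h1.differentiableAt (by simp)) h2 h3
  obtain ⟨ρ, hρ, hball⟩ := Metric.nhds_basis_closedBall.eventually_iff.1 hdiv
  obtain ⟨p, q, r, hp, hq, hr, -, hcurl⟩ := exists_primitive 0 hA hB hC (ρ := ρ)
    fun x hx => by simpa only [pow_zero, one_mul] using hball (by simpa using hx)
  simp only [pow_zero, one_mul] at hcurl
  have key : restr W3 (germ η hη) = K 0 ⟨p, hp⟩ + K 1 ⟨q, hq⟩ + K 2 ⟨r, hr⟩ := by
    rw [K_sum]
    refine congrArg _ (germ_congr ?_)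
    filter_upwards [e, Metric.closedBall_mem_nhds (0 : E 3) hρ] with x hx hx'
    obtain ⟨c1, c2, c3⟩ := hcurl x (by simpa using hx')
    rw [hx]
    simp only [form2, c1, c2, c3]
  refine (congrArg (· ∈ _) key).mpr ?_
  exact add_mem (add_mem (K_mem_span 0 _) (K_mem_span 1 _)) (K_mem_span 2 _)

/-! ### Linear independence of the restrictions in `ℝ³` -/

theorem dil_mem_W3 {x : E 3} (hx : x ∈ W3) (t : ℝ) : dil t x ∈ W3 := by
  obtain ⟨h1, h2⟩ := hx
  constructor <;> simp only [dil_apply, wt3, Matrix.cons_val]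
  · linear_combination t ^ 10 * h1
  · linear_combination t ^ 8 * h2

/-- Linear relations between the Taylor coefficients, up to quasi-degree `13`, of a function
vanishing on `W3`. -/
structure VanishingJet (c : ℕ × ℕ × ℕ → ℝ) : Prop where
  one : c (0, 0, 0) = 0
  z : c (0, 0, 1) = 0
  y : c (0, 1, 0) = 0
  x : c (1, 0, 0) = 0
  zz : c (0, 0, 2) = 0
  yz : c (0, 1, 1) = 0
  xz : c (1, 0, 1) = c (0, 2, 0)
  zzz : c (0, 0, 3) = 0
  xy : c (1, 1, 0) = 0
  xx : c (2, 0, 0) = c (0, 1, 2)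
  xzz : c (1, 0, 2) = c (0, 2, 1)
  zzzz : c (0, 0, 4) = 0
  xxz : c (2, 0, 1) = c (1, 2, 0) + c (0, 1, 3)

/-- On `W3` every quasi-homogeneous part of `g` vanishes; the relations are the values of these parts
at one point of each of the two branches of the curve. -/
theorem Jet.vanishing {g : E 3 → ℝ} {c : ℕ × ℕ × ℕ → ℝ} (h : Jet 14 g c)
    (hg : ∀ᶠ x in 𝓝 (0 : E 3), x ∈ W3 → g x = 0) : VanishingJet c := by
  -- points of the two branches, the third axis and the curve `(-t⁵, -t⁴, t³)`
  have hz : (![0, 0, 1] : E 3) ∈ W3 := by simp [W3]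
  have hc : (![-1, -1, 1] : E 3) ∈ W3 := by simp [W3]
  have key : ∀ x ∈ W3, ∀ (d : ℕ) (s : Finset (ℕ × ℕ × ℕ)), d < 14 →
      (expo 14).filter (fun e => wt e = d) = s → ∑ e ∈ s, c e * mono e x = 0 := by
    rintro x hx d s hd rfl
    refine h.homogeneous_eq_zero x ?_ hd
    filter_upwards [(tendsto_dil x).eventually hg] with t ht
    exact ht (dil_mem_W3 hx t)
  have c0 := key _ hc 0 {(0, 0, 0)} (by norm_num) (by decide)
  have c3 := key _ hc 3 {(0, 0, 1)} (by norm_num) (by decide)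
  have c4 := key _ hc 4 {(0, 1, 0)} (by norm_num) (by decide)
  have c5 := key _ hc 5 {(1, 0, 0)} (by norm_num) (by decide)
  have c6 := key _ hc 6 {(0, 0, 2)} (by norm_num) (by decide)
  have c7 := key _ hc 7 {(0, 1, 1)} (by norm_num) (by decide)
  have c8 := key _ hc 8 {(1, 0, 1), (0, 2, 0)} (by norm_num) (by decide)
  have c9 := key _ hc 9 {(0, 0, 3), (1, 1, 0)} (by norm_num) (by decide)
  have z9 := key _ hz 9 {(0, 0, 3), (1, 1, 0)} (by norm_num) (by decide)
  have c10 := key _ hc 10 {(2, 0, 0), (0, 1, 2)} (by norm_num) (by decide)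
  have c11 := key _ hc 11 {(1, 0, 2), (0, 2, 1)} (by norm_num) (by decide)
  have z12 := key _ hz 12 {(0, 0, 4), (0, 3, 0), (1, 1, 1)} (by norm_num) (by decide)
  have c13 := key _ hc 13 {(2, 0, 1), (1, 2, 0), (0, 1, 3)} (by norm_num) (by decide)
  simp [mono] at c0 c3 c4 c5 c6 c7 c8 c9 z9 c10 c11 z12 c13
  exact ⟨c0, c3, c4, c5, c6, c7, by linarith, z9, by linarith, by linarith, by linarith, z12,
    by linarith⟩

theorem Jet.of_le {D D' : ℕ} {g : E 3 → ℝ} {c : ℕ × ℕ × ℕ → ℝ} (h : Jet D g c) (hD : D' ≤ D) :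
    Jet D' g c := by
  have h1 := (Jet.of_mem_Hi (Hi_mono hD h)).add
    (Jet.sum (expo D) fun e _ => (Jet.monomial D' e).smul (c e))
  simp only [sub_add_cancel, zero_add] at h1
  refine h1.congr fun e he => ?_
  simp [mem_expo, he.trans_le hD]

/-- If `∑ c_k θ_k = α + dβ` near `0` with `α` and `β` vanishing on `W3`, then `c = 0`. The `c_k` are
Taylor coefficients of the left side, and combinations of the coefficients of the right side that
isolate each of them vanish by the relations of `VanishingJet`. -/
theorem theta_coeff_eq_zero {A B C p q r : E 3 → ℝ} (hA : ContDiff ℝ ∞ A) (hB : ContDiff ℝ ∞ B)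
    (hC : ContDiff ℝ ∞ C) (hp : ContDiff ℝ ∞ p) (hq : ContDiff ℝ ∞ q) (hr : ContDiff ℝ ∞ r)
    (vA : ∀ᶠ x in 𝓝 (0 : E 3), x ∈ W3 → A x = 0) (vB : ∀ᶠ x in 𝓝 (0 : E 3), x ∈ W3 → B x = 0)
    (vC : ∀ᶠ x in 𝓝 (0 : E 3), x ∈ W3 → C x = 0) (vp : ∀ᶠ x in 𝓝 (0 : E 3), x ∈ W3 → p x = 0)
    (vq : ∀ᶠ x in 𝓝 (0 : E 3), x ∈ W3 → q x = 0) (vr : ∀ᶠ x in 𝓝 (0 : E 3), x ∈ W3 → r x = 0)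
    {c : Fin 9 → ℝ}
    (h0 : (fun x => ∑ k, c k * thetaCoeff k 0 x) =ᶠ[𝓝 0] fun x => A x + (pd 1 r x - pd 2 q x))
    (h1 : (fun x => ∑ k, c k * thetaCoeff k 1 x) =ᶠ[𝓝 0] fun x => B x + (pd 0 r x - pd 2 p x))
    (h2 : (fun x => ∑ k, c k * thetaCoeff k 2 x) =ᶠ[𝓝 0] fun x => C x + (pd 0 q x - pd 1 p x)) :
    c = 0 := by
  -- `θ_9` has the coefficient `z³`, so the components along `dy ∧ dz` are compared in quasi-degrees
  -- less than `10`; this takes `r` up to `14`, since `∂/∂y` lowers the order by `4`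
  obtain ⟨jA, JA⟩ := Jet.exists_of_smooth hA 14
  obtain ⟨jB, JB⟩ := Jet.exists_of_smooth hB 14
  obtain ⟨jC, JC⟩ := Jet.exists_of_smooth hC 14
  obtain ⟨jp, Jp⟩ := Jet.exists_of_smooth hp 14
  obtain ⟨jq, Jq⟩ := Jet.exists_of_smooth hq 14
  obtain ⟨jr, Jr⟩ := Jet.exists_of_smooth hr 14
  have VA := JA.vanishing vA
  have VB := JB.vanishing vB
  have VC := JC.vanishing vC
  have Vp := Jp.vanishing vp
  have Vq := Jq.vanishing vq
  have Vr := Jr.vanishing vr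
  have m := fun (D : ℕ) (k : Fin 9) (e : ℕ × ℕ × ℕ) => (Jet.monomial D e).smul (c k)
  -- `T` and `R`: expansions of the left and right sides of `h0`, `h1`, `h2`
  have T0 := ((((m 10 0 (0, 0, 0)).add (m 10 3 (0, 0, 1))).add (m 10 5 (1, 0, 0))).add
    (m 10 6 (0, 0, 2))).add (m 10 8 (0, 0, 3))
  have T1 := (((m 9 1 (0, 0, 0)).add (m 9 4 (0, 0, 1))).add (m 9 5 (0, 1, 0))).add
    (m 9 7 (0, 0, 2))
  have T2 := m 9 2 (0, 0, 0)
  have R0 := (JA.of_le (D' := 10) (by norm_num)).add ((Jr.pd hr 1).sub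
    ((Jq.pd hq 2).of_le (D' := 10) (by decide)))
  have R1 := (JB.of_le (D' := 9) (by norm_num)).add ((Jr.pd hr 0).sub
    ((Jp.pd hp 2).of_le (D' := 9) (by decide)))
  have R2 := (JC.of_le (D' := 9) (by norm_num)).add ((Jq.pd hq 0).sub
    ((Jp.pd hp 1).of_le (D' := 9) (by decide)))
  have t0 : (fun x => c 0 * mono (0, 0, 0) x + c 3 * mono (0, 0, 1) x + c 5 * mono (1, 0, 0) x +
      c 6 * mono (0, 0, 2) x + c 8 * mono (0, 0, 3) x) = fun x => ∑ k, c k * thetaCoeff k 0 x := by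
    ext x; simp [Fin.sum_univ_succ, thetaCoeff, mono]; ring
  have t1 : (fun x => c 1 * mono (0, 0, 0) x + c 4 * mono (0, 0, 1) x + c 5 * mono (0, 1, 0) x +
      c 7 * mono (0, 0, 2) x) = fun x => ∑ k, c k * thetaCoeff k 1 x := by
    ext x; simp [Fin.sum_univ_succ, thetaCoeff, mono]; ring
  have t2 : (fun x => c 2 * mono (0, 0, 0) x) = fun x => ∑ k, c k * thetaCoeff k 2 x := by
    ext x; simp [Fin.sum_univ_succ, thetaCoeff, mono]
  rw [t0] at T0
  rw [t1] at T1
  rw [t2] at T2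
  have e0 := fun (e : ℕ × ℕ × ℕ) he => T0.unique R0 h0 (e := e) he
  have e1 := fun (e : ℕ × ℕ × ℕ) he => T1.unique R1 h1 (e := e) he
  have e2 := fun (e : ℕ × ℕ × ℕ) he => T2.unique R2 h2 (e := e) he
  -- `a`, `b`, `c`: coefficients along `dy ∧ dz`, `dx ∧ dz`, `dx ∧ dy`
  have a1 := e0 (0, 0, 0) (by decide)
  have az := e0 (0, 0, 1) (by decide)
  have ay := e0 (0, 1, 0) (by decide)
  have azz := e0 (0, 0, 2) (by decide)
  have ayz := e0 (0, 1, 1) (by decide)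
  have azzz := e0 (0, 0, 3) (by decide)
  have axy := e0 (1, 1, 0) (by decide)
  have b1 := e1 (0, 0, 0) (by decide)
  have bz := e1 (0, 0, 1) (by decide)
  have b_y := e1 (0, 1, 0) (by decide)
  have bx := e1 (1, 0, 0) (by decide)
  have bzz := e1 (0, 0, 2) (by decide)
  have bxz := e1 (1, 0, 1) (by decide)
  have byy := e1 (0, 2, 0) (by decide)
  have c1 := e2 (0, 0, 0) (by decide)
  have cy := e2 (0, 1, 0) (by decide)
  have cx := e2 (1, 0, 0) (by decide)
  have cyz := e2 (0, 1, 1) (by decide)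
  simp [degIn, unitExp, VA.one, VA.z, VA.y, VA.zz, VA.yz, VA.zzz, VA.xy, Vr.y, Vr.yz,
    Vq.z, Vq.zz, Vq.yz, Vq.zzz, Vq.zzzz] at a1 az ay azz ayz azzz axy
  simp [degIn, unitExp, VB.one, VB.z, VB.y, VB.x, VB.zz, Vr.x, Vr.xy,
    Vp.z, Vp.zz, Vp.yz, Vp.zzz, VB.xz, Vp.xzz, Vr.xxz, Vp.xz] at b1 bz b_y bx bzz bxz byy
  simp [degIn, unitExp, VC.one, VC.y, VC.x, VC.yz, Vq.x, Vp.y, Vp.xy, Vq.xy] at c1 cy cx cyz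
  have r1 := Vr.xz
  have r2 := Vr.xx
  have r3 := Vr.xzz
  have r4 := Vq.xx
  ext k
  fin_cases k <;> simp <;> linarith

/-- A germ of a `1`-form vanishing on `N` has coefficients vanishing on `N`. -/
theorem exists_form1_of_mem_LamVanish {N : Set (E 3)} {g : Lam 3 1} (hg : g ∈ LamVanish N 1) :
    ∃ (p q r : E 3 → ℝ) (hp : ContDiff ℝ ∞ p) (hq : ContDiff ℝ ∞ q) (hr : ContDiff ℝ ∞ r),
      g = germ (form1 p q r) (form1_contDiff hp hq hr).smoothNearZero ∧
      ∀ᶠ x in 𝓝 (0 : E 3), x ∈ N → p x = 0 ∧ q x = 0 ∧ r x = 0 := by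
  obtain ⟨_, η, hη, rfl⟩ := g
  obtain ⟨η', e, hv⟩ := hg
  have e := toGerm_eq.1 e
  have comp : ∀ v : Fin 1 → E 3, ∃ f : E 3 → ℝ, ContDiff ℝ ∞ f ∧ (fun x => η x v) =ᶠ[𝓝 0] f :=
    fun v => exists_smooth_extension (hη.mono fun x hx =>
      (ContinuousAlternatingMap.apply ℝ (E 3) ℝ v).contDiff.contDiffAt.comp x hx)
  obtain ⟨p, hp, ep⟩ := comp ![Pi.single 0 1]
  obtain ⟨q, hq, eq⟩ := comp ![Pi.single 1 1]
  obtain ⟨r, hr, er⟩ := comp ![Pi.single 2 1]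
  refine ⟨p, q, r, hp, hq, hr, germ_congr (h := hη) ?_, ?_⟩
  · filter_upwards [ep, eq, er] with x h0 h1 h2
    rw [oneForm_eq (η x), form1, ← h0, ← h1, ← h2]
  · filter_upwards [ep, eq, er, e, hv] with x h0 h1 h2 h3 h4 hx
    rw [← h0, ← h1, ← h2, ← h3, h4 hx]
    exact ⟨rfl, rfl, rfl⟩

/-- A germ of a `2`-form vanishing on `N` has coefficients vanishing on `N`. -/
theorem exists_form2_of_mem_LamVanish {N : Set (E 3)} {g : Lam 3 2} (hg : g ∈ LamVanish N 2) :
    ∃ (A B C : E 3 → ℝ) (hA : ContDiff ℝ ∞ A) (hB : ContDiff ℝ ∞ B) (hC : ContDiff ℝ ∞ C),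
      g = germ (form2 A B C) (form2_contDiff hA hB hC).smoothNearZero ∧
      ∀ᶠ x in 𝓝 (0 : E 3), x ∈ N → A x = 0 ∧ B x = 0 ∧ C x = 0 := by
  obtain ⟨_, η, hη, rfl⟩ := g
  obtain ⟨η', e, hv⟩ := hg
  have e := toGerm_eq.1 e
  obtain ⟨A, B, C, hA, hB, hC, eA, eB, eC⟩ := exists_coefficients hη
  refine ⟨A, B, C, hA, hB, hC, germ_congr (h := hη) ?_, ?_⟩
  · filter_upwards [eA, eB, eC] with x h0 h1 h2
    rw [twoForm_eq (η x), form2, ← h0, ← h1, ← h2]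
  · filter_upwards [eA, eB, eC, e, hv] with x h0 h1 h2 h3 h4 hx
    rw [← h0, ← h1, ← h2, ← h3, h4 hx]
    exact ⟨rfl, rfl, rfl⟩

/-- The nine classes are linearly independent in `ℝ³`. -/
theorem theta3_independent {c : Fin 9 → ℝ} (h : ∑ k, c k • theta3Germ k ∈ A0 W3) : c = 0 := by
  obtain ⟨α, hα, _, ⟨β, hβ, rfl⟩, h⟩ := Submodule.mem_sup.1 h
  obtain ⟨A, B, C, hA, hB, hC, rfl, hv⟩ := exists_form2_of_mem_LamVanish hα
  obtain ⟨p, q, r, hp, hq, hr, rfl, hw⟩ := exists_form1_of_mem_LamVanish hβ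
  rw [d_germ] at h
  have e1 : (∑ k, c k • theta3Germ k).1 = toGerm 3 2 (∑ k, c k • theta3 k) := by
    rw [map_sum]
    simp only [map_smul]
    rw [AddSubmonoidClass.coe_finsetSum]
    rfl
  have e : (form2 A B C + extDeriv (form1 p q r)) =ᶠ[𝓝 0] ∑ k, c k • theta3 k :=
    toGerm_eq.1 ((congrArg Subtype.val h).trans e1)
  rw [extDeriv_form1 hp hq hr] at e
  have ev : ∀ (v : Fin 2 → E 3), ∀ᶠ x in 𝓝 0, ∑ k, c k * theta3 k x v = form2 A B C x v +
      form2 (fun x => pd 1 r x - pd 2 q x) (fun x => pd 0 r x - pd 2 p x)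
        (fun x => pd 0 q x - pd 1 p x) x v := fun v => by
    filter_upwards [e] with x hx
    have := congrArg (fun η => η v) hx
    simp only [Finset.sum_apply, Pi.smul_apply, Pi.add_apply, ContinuousAlternatingMap.add_apply,
      ContinuousAlternatingMap.sum_apply, ContinuousAlternatingMap.smul_apply, smul_eq_mul] at this
    exact this.symm
  refine theta_coeff_eq_zero hA hB hC hp hq hr (hv.mono fun x h hx => (h hx).1)
    (hv.mono fun x h hx => (h hx).2.1) (hv.mono fun x h hx => (h hx).2.2)
    (hw.mono fun x h hx => (h hx).1) (hw.mono fun x h hx => (h hx).2.1)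
    (hw.mono fun x h hx => (h hx).2.2) ?_ ?_ ?_
  · filter_upwards [ev ![Pi.single 1 1, Pi.single 2 1]] with x hx
    simpa [form2_apply, theta3] using hx
  · filter_upwards [ev ![Pi.single 0 1, Pi.single 2 1]] with x hx
    simpa [form2_apply, theta3] using hx
  · filter_upwards [ev ![Pi.single 0 1, Pi.single 1 1]] with x hx
    simpa [form2_apply, theta3] using hx

/-! ### Linear pullbacks of germs and the reduction to `ℝ³` -/

section Pullback

variable {m k : ℕ}

/-- The pullback of a form by a linear map. -/
def pullForm {p : ℕ} (L : E m →L[ℝ] E k) (η : Form k p) : Form m p := fun x =>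
  (η (L x)).compContinuousLinearMap L

theorem tendsto_linear (L : E m →L[ℝ] E k) : Tendsto L (𝓝 0) (𝓝 0) := by
  simpa using L.continuous.tendsto 0

theorem SmoothNearZero.pullForm {p : ℕ} (L : E m →L[ℝ] E k) {η : Form k p}
    (h : SmoothNearZero η) : SmoothNearZero (pullForm L η) := by
  filter_upwards [(tendsto_linear L).eventually h] with x hx
  exact (ContinuousAlternatingMap.compContinuousLinearMapCLM L).contDiff.contDiffAt.comp x
    (ContDiffAt.comp x hx L.contDiff.contDiffAt)

/-- The pullback of germs of forms by a linear map. -/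
def pull {p : ℕ} (L : E m →L[ℝ] E k) : Lam k p →ₗ[ℝ] Lam m p where
  toFun g := ⟨Germ.map' (pullForm L) (fun _ _ h =>
    ((tendsto_linear L).eventually h).mono fun x hx => by simp only [AlgRestr.pullForm, hx]) g.1, by
    obtain ⟨_, η, hη, rfl⟩ := g
    exact ⟨pullForm L η, hη.pullForm L, rfl⟩⟩
  map_add' := by
    rintro ⟨_, η, hη, rfl⟩ ⟨_, η', hη', rfl⟩
    exact Subtype.ext (toGerm_eq.2 (Eventually.of_forall fun x => rfl))
  map_smul' := by
    rintro c ⟨_, η, hη, rfl⟩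
    exact Subtype.ext (toGerm_eq.2 (Eventually.of_forall fun x => rfl))

theorem pull_germ {p : ℕ} (L : E m →L[ℝ] E k) (η : Form k p) (h : SmoothNearZero η) :
    pull L (germ η h) = germ (pullForm L η) (h.pullForm L) := rfl

theorem pull_d {p : ℕ} (L : E m →L[ℝ] E k) (g : Lam k p) :
    d m p (pull L g) = pull L (d k p g) := by
  obtain ⟨_, η, hη, rfl⟩ := g
  refine Subtype.ext (toGerm_eq.2 ?_)
  filter_upwards [(tendsto_linear L).eventually hη] with x hx
  have hd : DifferentiableAt ℝ η (L x) := hx.differentiableAt (by simp)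
  have := extDeriv_pullback (x := x) (f := L) (r := ∞) hd L.contDiff.contDiffAt
    (by simpa using WithTop.coe_le_coe.2 (le_top : (2 : ℕ∞) ≤ ⊤))
  simp only [ContinuousLinearMap.fderiv] at this
  exact this

theorem pull_mem_Closed (L : E m →L[ℝ] E k) {g : Lam k 2} (hg : g ∈ Closed k) :
    pull L g ∈ Closed m := by
  have : d k 2 g = 0 := hg
  show d m 2 (pull L g) = 0
  rw [pull_d, this, map_zero]

theorem pull_mem_LamVanish {p : ℕ} (L : E m →L[ℝ] E k) {N : Set (E m)} {N' : Set (E k)}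
    (hL : ∀ x ∈ N, L x ∈ N') {g : Lam k p} (hg : g ∈ LamVanish N' p) :
    pull L g ∈ LamVanish N p := by
  obtain ⟨_, η, hη, rfl⟩ := g
  obtain ⟨η', e, hv⟩ := hg
  refine ⟨pullForm L η', toGerm_eq.2 ?_, ?_⟩
  · filter_upwards [(tendsto_linear L).eventually (toGerm_eq.1 e)] with x hx
    simp only [AlgRestr.pullForm, hx]
  · filter_upwards [(tendsto_linear L).eventually hv] with x hx hxN
    rw [AlgRestr.pullForm, hx (hL x hxN)]
    rfl

theorem pull_mem_A0 (L : E m →L[ℝ] E k) {N : Set (E m)} {N' : Set (E k)}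
    (hL : ∀ x ∈ N, L x ∈ N') {g : Lam k 2} (hg : g ∈ A0 N') : pull L g ∈ A0 N := by
  obtain ⟨α, hα, _, ⟨β, hβ, rfl⟩, rfl⟩ := Submodule.mem_sup.1 hg
  rw [map_add, ← pull_d]
  exact add_mem (Submodule.mem_sup_left (pull_mem_LamVanish L hL hα))
    (Submodule.mem_sup_right (Submodule.mem_map_of_mem (pull_mem_LamVanish L hL hβ)))

/-- Contraction with a vector, as a continuous linear map. -/
def curryLeftL : ((E m) [⋀^Fin 2]→L[ℝ] ℝ) →L[ℝ] (E m →L[ℝ] (E m) [⋀^Fin 1]→L[ℝ] ℝ) :=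
  (ContinuousAlternatingMap.curryLeftLI (𝕜 := ℝ) (E := E m) (F := ℝ)
    (n := 1)).toContinuousLinearMap

/-- At a fixed point of `π` the vector `x - πx` is zero, so only its own derivative contributes to
that of the contraction. -/
theorem fderiv_contract {η : Form m 2} (π : E m →L[ℝ] E m) (w : E m) {x : E m}
    (hη : DifferentiableAt ℝ η x) (hx : π x = x) (v : E m) :
    fderiv ℝ (fun y => η y ![y - π y, w]) x v = η x ![v - π v, w] := by
  let T : ((E m) [⋀^Fin 2]→L[ℝ] ℝ) →L[ℝ] (E m →L[ℝ] ℝ) :=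
    (ContinuousLinearMap.compL ℝ (E m) ((E m) [⋀^Fin 1]→L[ℝ] ℝ) ℝ
      (ContinuousAlternatingMap.apply ℝ (E m) ℝ ![w])).comp curryLeftL
  have hT : ∀ (ζ : (E m) [⋀^Fin 2]→L[ℝ] ℝ) (u : E m), T ζ u = ζ ![u, w] := fun ζ u => rfl
  have h1 : HasFDerivAt (fun y => T (η y)) (T.comp (fderiv ℝ η x)) x :=
    T.hasFDerivAt.comp x hη.hasFDerivAt
  have h2 : HasFDerivAt (fun y => y - π y) (ContinuousLinearMap.id ℝ (E m) - π) x :=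
    (hasFDerivAt_id x).sub π.hasFDerivAt
  have h3 := (h1.clm_apply h2).fderiv
  have h4 : fderiv ℝ (fun y => η y ![y - π y, w]) x = _ := h3
  rw [h4]
  simp [hT, hx]

/-- A form and its pullback by a linear map that fixes `N` pointwise have the same
algebraic restriction to `N`. -/
theorem sub_pull_mem_A0 (π : E m →L[ℝ] E m) {N : Set (E m)} (hN : ∀ x ∈ N, π x = x)
    (g : Lam m 2) : g - pull π g ∈ A0 N := by
  obtain ⟨_, η, hη, rfl⟩ := g
  -- the primitive `β = ω(x - πx, ·)` of the difference along `N`, where the argument `w` is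
  -- replaced with `(w + πw) / 2` to count the component of `ω` normal to `N` only once
  let L : E m →L[ℝ] E m := (1 / 2 : ℝ) • (ContinuousLinearMap.id ℝ (E m) + π)
  let β : Form m 1 := fun x => ((η x).curryLeft (x - π x)).compContinuousLinearMap L
  have hβ : SmoothNearZero β := by
    filter_upwards [hη] with x hx
    have h1 : ContDiffAt ℝ ∞ (fun y => (η y).curryLeft (y - π y)) x := by
      have h3 : ContDiff ℝ ∞ fun ζ => curryLeftL (m := m) ζ := by fun_prop
      have h2 : ContDiffAt ℝ ∞ (fun y => (η y).curryLeft) x := h3.contDiffAt.comp x hx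
      exact h2.clm_apply (contDiffAt_id.sub π.contDiff.contDiffAt)
    exact (ContinuousAlternatingMap.compContinuousLinearMapCLM L).contDiff.contDiffAt.comp x h1
  have hβN : germ β hβ ∈ LamVanish N 1 := by
    refine germ_mem_LamVanish hβ fun x hx => ?_
    ext v
    simp [β, hN x hx]
  have hβv : ∀ x (v : Fin 1 → E m), β x v = η x ![x - π x, L (v 0)] := by
    intro x v
    have : L ∘ v = ![L (v 0)] := by ext i; fin_cases i; rfl
    simp only [β, ContinuousAlternatingMap.compContinuousLinearMap_apply, this]
    rfl
  have hd : ∀ᶠ x in 𝓝 (0 : E m), x ∈ N → (η - pullForm π η - extDeriv β) x = 0 := by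
    filter_upwards [hη, hβ] with x hx hx' hxN
    have hdη : DifferentiableAt ℝ η x := hx.differentiableAt (by simp)
    rw [Pi.sub_apply, Pi.sub_apply, sub_eq_zero]
    ext v
    rw [extDeriv_apply (hx'.differentiableAt (by simp)), Fin.sum_univ_two]
    simp only [hβv, fderiv_contract π _ hdη (hN x hxN)]
    have e1 : pullForm π η x v = η x ![π (v 0), π (v 1)] := by
      have : π ∘ v = ![π (v 0), π (v 1)] := by ext i; fin_cases i <;> rfl
      simp only [AlgRestr.pullForm, ContinuousAlternatingMap.compContinuousLinearMap_apply, this,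
        hN x hxN]
    rw [ContinuousAlternatingMap.sub_apply, e1, ← pair_eta v]
    generalize v 0 = a
    generalize v 1 = b
    obtain ⟨a', ha⟩ : ∃ a', a' = a - π a := ⟨_, rfl⟩
    obtain ⟨b', hb⟩ : ∃ b', b' = b - π b := ⟨_, rfl⟩
    have ea : a = π a + a' := by rw [ha]; abel
    have eb : b = π b + b' := by rw [hb]; abel
    have eL : ∀ u u', u = π u + u' → L u = π u + (1 / 2 : ℝ) • u' := fun u u' hu => by
      have : L u = (1 / 2 : ℝ) • (u + π u) := rfl
      rw [this]
      nth_rewrite 1 [hu]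
      module
    have e2 : (Fin.removeNth 0 ![a, b] : Fin 1 → E m) 0 = b := rfl
    have e3 : (Fin.removeNth 1 ![a, b] : Fin 1 → E m) 0 = a := rfl
    simp only [Matrix.cons_val_zero, Matrix.cons_val_one, e2, e3, eL a a' ea, eL b b' eb, ← ha,
      ← hb]
    have e4 : η x ![a, b] = η x ![π a + a', π b + b'] := by rw [← ea, ← eb]
    rw [e4]
    simp only [twoForm_add_left, twoForm_add_right, twoForm_smul_right]
    rw [twoForm_swap (η x) b' (π a), twoForm_swap (η x) b' a']
    simp
    ring
  have hα : SmoothNearZero (η - pullForm π η - extDeriv β) := by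
    have h1 := (hη.add ((hη.pullForm π).smul (-1))).add (hβ.extDeriv.smul (-1))
    have e : η - pullForm π η - extDeriv β =
        η + (-1 : ℝ) • pullForm π η + (-1 : ℝ) • extDeriv β := by module
    rw [e]
    exact h1
  have h2 : germ η hη - pull π (germ η hη) =
      germ (η - pullForm π η - extDeriv β) hα + d m 1 (germ β hβ) := by
    refine Subtype.ext (toGerm_eq.2 (Eventually.of_forall fun x => ?_))
    simp
  refine (congrArg (· ∈ A0 N) h2).mpr ?_
  exact add_mem (Submodule.mem_sup_left ⟨_, rfl, hd⟩)
    (Submodule.mem_sup_right (Submodule.mem_map_of_mem hβN))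

end Pullback

section Reduction

variable {n : ℕ} (hn : 2 ≤ n)

/-- The projection of `ℝ^{2n}` onto the first three coordinates. -/
def pr : E (2 * n) →L[ℝ] E 3 := ContinuousLinearMap.pi fun k => ContinuousLinearMap.proj (idx hn k)

/-- The inclusion of `ℝ³` in `ℝ^{2n}` as the space of the first three coordinates. -/
def incl : E 3 →L[ℝ] E (2 * n) := ContinuousLinearMap.pi fun i =>
  if h : i.val < 3 then ContinuousLinearMap.proj (⟨i.val, h⟩ : Fin 3) else 0

theorem pr_apply (x : E (2 * n)) (k : Fin 3) : pr hn x k = x (idx hn k) := rfl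

theorem incl_idx (y : E 3) (k : Fin 3) : incl (n := n) y (idx hn k) = y k := by
  simp [incl, idx]

theorem incl_of_le (y : E 3) {i : Fin (2 * n)} (hi : 3 ≤ i.val) : incl y i = 0 := by
  simp [incl, not_lt.2 hi]

theorem eq_idx {i : Fin (2 * n)} (hi : i.val < 3) : i = idx hn ⟨i.val, hi⟩ := rfl

theorem pr_incl (y : E 3) : pr hn (incl y) = y := by
  ext k
  rw [pr_apply, incl_idx]

theorem pr_mem {x : E (2 * n)} (hx : x ∈ W9 hn) : pr hn x ∈ W3 := ⟨hx.1, hx.2.1⟩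

theorem incl_mem {y : E 3} (hy : y ∈ W3) : incl y ∈ W9 hn := by
  refine ⟨?_, ?_, fun i hi => incl_of_le y hi⟩
  · simpa only [incl_idx] using hy.1
  · simpa only [incl_idx] using hy.2

theorem incl_pr {x : E (2 * n)} (hx : x ∈ W9 hn) : incl (pr hn x) = x := by
  ext i
  by_cases hi : i.val < 3
  · rw [eq_idx hn hi, incl_idx, pr_apply]
  · rw [incl_of_le _ (not_lt.1 hi), hx.2.2 i (not_lt.1 hi)]

/-- Every germ has the same algebraic restriction as the pullback, by the projection, of its
restriction to `ℝ³`. -/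
theorem sub_pull_pr_mem_A0 (g : Lam (2 * n) 2) :
    g - pull (pr hn) (pull incl g) ∈ A0 (W9 hn) := by
  have h := sub_pull_mem_A0 (incl.comp (pr hn)) (N := W9 hn)
    (fun x hx => incl_pr hn hx) g
  obtain ⟨_, η, hη, rfl⟩ := g
  exact h

theorem pullForm_pr_theta3 (k : Fin 9) : pullForm (pr hn) (theta3 k) = theta hn k := by
  ext x v
  fin_cases k <;>
    simp [pullForm, theta3, form2_apply, thetaCoeff, theta, pr_apply, dxdx_apply]

theorem pullForm_incl_theta (k : Fin 9) : pullForm incl (theta hn k) = theta3 k := by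
  rw [← pullForm_pr_theta3]
  ext x v
  simp only [pullForm, ContinuousAlternatingMap.compContinuousLinearMap_apply, pr_incl]
  congr 1
  ext i j
  simp [pr_incl]

theorem pull_pr_theta3Germ (k : Fin 9) : pull (pr hn) (theta3Germ k) = thetaGerm hn k := by
  rw [theta3Germ, pull_germ]
  exact germ_congr (Eventually.of_forall fun x => congrFun (pullForm_pr_theta3 hn k) x)

theorem pull_incl_thetaGerm (k : Fin 9) : pull incl (thetaGerm hn k) = theta3Germ k := by
  exact germ_congr (h := (theta_contDiff hn k).smoothNearZero.pullForm incl)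
    (Eventually.of_forall fun x => congrFun (pullForm_incl_theta hn k) x)

theorem theta_independent {c : Fin 9 → ℝ} (h : ∑ k, c k • thetaGerm hn k ∈ A0 (W9 hn)) :
    c = 0 := by
  refine theta3_independent ?_
  have := pull_mem_A0 incl (fun y hy => incl_mem hn hy) h
  simpa only [map_sum, map_smul, pull_incl_thetaGerm] using this

theorem exists_theta_combination {g : Lam (2 * n) 2} (hg : g ∈ Closed (2 * n)) :
    ∃ c : Fin 9 → ℝ, g - ∑ k, c k • thetaGerm hn k ∈ A0 (W9 hn) := by
  obtain ⟨c, hc⟩ := (Submodule.mem_span_range_iff_exists_fun ℝ).1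
    (restr_mem_span (pull_mem_Closed incl hg))
  refine ⟨c, ?_⟩
  have h1 : pull incl g - ∑ k, c k • theta3Germ k ∈ A0 W3 := by
    rw [← Submodule.Quotient.mk_eq_zero]
    have h2 : restr W3 (pull incl g - ∑ k, c k • theta3Germ k) = 0 := by
      rw [map_sub, map_sum]
      simp only [map_smul, hc, sub_self]
    exact h2
  have h2 := pull_mem_A0 (pr hn) (fun x hx => pr_mem hn hx) h1
  have h3 := add_mem (sub_pull_pr_mem_A0 hn g) h2
  simpa only [map_sub, map_sum, map_smul, pull_pr_theta3Germ, sub_add_sub_cancel] using h3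

end Reduction

/-! ### Closedness and quasi-homogeneity of the generators -/

theorem extDeriv_form2_eq_zero {A B C : E 3 → ℝ} (hA : ContDiff ℝ ∞ A) (hB : ContDiff ℝ ∞ B)
    (hC : ContDiff ℝ ∞ C) (hdiv : ∀ x, pd 0 A x - pd 1 B x + pd 2 C x = 0) :
    extDeriv (form2 A B C) = 0 := by
  ext x v
  rw [extDeriv_apply ((form2_contDiff hA hB hC).differentiable (by simp) x)]
  have key : ∀ (a b c : ℝ) (w : E 3), fderiv ℝ (fun y => A y * a + B y * b + C y * c) x w =
      fderiv ℝ A x w * a + fderiv ℝ B x w * b + fderiv ℝ C x w * c := by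
    intro a b c w
    have h1 := (((hA.diffAt x).hasFDerivAt.mul_const a).add
      ((hB.diffAt x).hasFDerivAt.mul_const b)).add ((hC.diffAt x).hasFDerivAt.mul_const c)
    have h2 : fderiv ℝ (fun y => A y * a + B y * b + C y * c) x = _ := h1.fderiv
    rw [h2]
    simp [mul_comm]
  have s21 : Fin.succAbove (2 : Fin 3) (1 : Fin 2) = 1 := rfl
  rw [Fin.sum_univ_three]
  simp only [form2_apply, key, fderiv_eq_pd]
  simp [Fin.removeNth, s21]
  linear_combination (v 0 0 * (v 1 1 * v 2 2 - v 1 2 * v 2 1) - v 0 1 * (v 1 0 * v 2 2 -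
    v 1 2 * v 2 0) + v 0 2 * (v 1 0 * v 2 1 - v 1 1 * v 2 0)) * hdiv x

/-- Only `θ_6` has a coefficient with a nonzero term in the divergence, and there the terms of `x` and
`y` cancel. -/
theorem theta3Germ_mem_Closed (k : Fin 9) : theta3Germ k ∈ Closed 3 := by
  have h : extDeriv (theta3 k) = 0 := by
    refine extDeriv_form2_eq_zero (thetaCoeff_smooth k 0) (thetaCoeff_smooth k 1)
      (thetaCoeff_smooth k 2) fun x => ?_
    fin_cases k <;>
      simp [thetaCoeff, pd_const, pd_coord, pd_pow (coord_smooth 2)]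
  exact Subtype.ext (toGerm_eq.2 (Eventually.of_forall fun x => congrFun h x))

theorem thetaGerm_mem_Closed {n : ℕ} (hn : 2 ≤ n) (k : Fin 9) :
    thetaGerm hn k ∈ Closed (2 * n) := by
  rw [← pull_pr_theta3Germ]
  exact pull_mem_Closed _ (theta3Germ_mem_Closed k)

theorem theta_isQuasiHomogeneous {n : ℕ} (hn : 2 ≤ n) {w : Fin (2 * n) → ℝ}
    (h0 : w (idx hn 0) = 5) (h1 : w (idx hn 1) = 4) (h2 : w (idx hn 2) = 3) (k : Fin 9) :
    IsQuasiHomogeneous w (delta k) (theta hn k) := by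
  intro t ht x
  have hd : ∀ (y : E (2 * n)) (i : Fin (2 * n)), dilation w t y i = t ^ w i * y i :=
    fun y i => rfl
  ext v
  fin_cases k <;> simp [theta, delta, dxdx_apply, hd, h0, h1, h2] <;> ring

/-! ### Symplectic representatives -/

section Symplectic

variable {n : ℕ} (hn : 2 ≤ n)

theorem germ_sum_theta (c : Fin 9 → ℝ) :
    (∑ k, c k • thetaGerm hn k).1 = toGerm (2 * n) 2 (∑ k, c k • theta hn k) := by
  rw [map_sum]
  simp only [map_smul]
  rw [AddSubmonoidClass.coe_finsetSum]
  rfl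

theorem sum_theta_apply (c : Fin 9 → ℝ) (x v w : E (2 * n)) :
    (∑ k, c k • theta hn k) x ![v, w] =
      (∑ k, c k * thetaCoeff k 0 (pr hn x)) * (pr hn v 1 * pr hn w 2 - pr hn v 2 * pr hn w 1) +
      (∑ k, c k * thetaCoeff k 1 (pr hn x)) * (pr hn v 0 * pr hn w 2 - pr hn v 2 * pr hn w 0) +
      (∑ k, c k * thetaCoeff k 2 (pr hn x)) * (pr hn v 0 * pr hn w 1 - pr hn v 1 * pr hn w 0) := by
  simp only [← pullForm_pr_theta3, Finset.sum_apply, Pi.smul_apply,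
    ContinuousAlternatingMap.sum_apply, ContinuousAlternatingMap.smul_apply, smul_eq_mul,
    Finset.sum_mul, ← Finset.sum_add_distrib]
  refine Finset.sum_congr rfl fun k _ => ?_
  simp only [pullForm, ContinuousAlternatingMap.compContinuousLinearMap_apply, theta3, form2_apply,
    Function.comp_apply, Matrix.cons_val_zero, Matrix.cons_val_one]
  ring

/-- Adding to `∑ c_k θ_k` a constant form that vanishes on `ℝ³` does not change the algebraic
restriction; if the sum is nondegenerate, the restriction is symplectic. -/
theorem mem_sympRestr_of_nondeg (c : Fin 9 → ℝ) (κ : (E (2 * n)) [⋀^Fin 2]→L[ℝ] ℝ)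
    (hκ : κ.compContinuousLinearMap incl = 0)
    (h : ∀ᶠ x in 𝓝 (0 : E (2 * n)), Nondeg ((∑ k, c k • theta hn k) x + κ)) :
    restr (W9 hn) (∑ k, c k • thetaGerm hn k) ∈ sympRestr (W9 hn) := by
  have sκ : SmoothNearZero (fun _ : E (2 * n) => κ) := contDiff_const.smoothNearZero
  have cκ : germ _ sκ ∈ Closed (2 * n) := by
    refine Subtype.ext (toGerm_eq.2 (Eventually.of_forall fun x => ?_))
    ext v
    rw [extDeriv_apply (differentiableAt_const _)]
    simp
  have rκ : germ _ sκ ∈ A0 (W9 hn) := by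
    have h1 := sub_pull_pr_mem_A0 hn (germ _ sκ)
    have h2 : pull incl (germ _ sκ) = 0 :=
      Subtype.ext (toGerm_eq.2 (Eventually.of_forall fun x => hκ))
    rwa [h2, map_zero, sub_zero] at h1
  refine ⟨∑ k, c k • thetaGerm hn k + germ _ sκ, ⟨add_mem (sum_mem fun k _ =>
    Submodule.smul_mem _ _ (thetaGerm_mem_Closed hn k)) cκ, ?_⟩, ?_⟩
  · have e : (∑ k, c k • thetaGerm hn k + germ _ sκ).1 =
        toGerm (2 * n) 2 (fun x => (∑ k, c k • theta hn k) x + κ) := by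
      rw [Submodule.coe_add, germ_sum_theta]
      rfl
    rw [e]
    exact h
  · rw [map_add]
    have : restr (W9 hn) (germ _ sκ) = 0 := (Submodule.Quotient.mk_eq_zero _).2 rκ
    rw [this, add_zero]

theorem pr_single_of_le {i : Fin (2 * n)} (hi : 3 ≤ i.val) : pr hn (Pi.single i 1) = 0 := by
  ext k
  rw [pr_apply, Pi.single_apply, if_neg]
  · rfl
  · rintro rfl
    have : (idx hn k).val = k.val := rfl
    omega

/-- For `n ≥ 3` adding `∑ dx_i ∧ dx_{i+n}` makes every combination of the `θ_k` symplectic. -/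
theorem mem_sympRestr_of_three_le (h3 : 3 ≤ n) (c : Fin 9 → ℝ) :
    restr (W9 hn) (∑ k, c k • thetaGerm hn k) ∈ sympRestr (W9 hn) := by
  let lo : Fin n → Fin (2 * n) := fun i => ⟨i.val, by omega⟩
  let hi : Fin n → Fin (2 * n) := fun i => ⟨i.val + n, by omega⟩
  have hlo : Function.Injective lo := fun i j h => Fin.ext (by simpa [lo] using h)
  have hhi : Function.Injective hi := fun i j h => Fin.ext (by simpa [hi] using h)
  have hne : ∀ i j, lo i ≠ hi j := fun i j h => by
    have := congrArg Fin.val h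
    simp [lo, hi] at this
    omega
  let κ : (E (2 * n)) [⋀^Fin 2]→L[ℝ] ℝ := ∑ i, dxdx (lo i) (hi i)
  have κ_apply : ∀ v w, κ ![v, w] = ∑ i, (v (lo i) * w (hi i) - v (hi i) * w (lo i)) := by
    intro v w
    simp [κ, ContinuousAlternatingMap.sum_apply, dxdx_apply]
  refine mem_sympRestr_of_nondeg hn c κ ?_ (Eventually.of_forall fun x v hv => ?_)
  · ext v
    rw [ContinuousAlternatingMap.compContinuousLinearMap_apply, ← pair_eta (incl ∘ v), κ_apply]
    have : ∀ (y : E 3) i, incl y (hi i) = 0 := fun y i => incl_of_le y (by simp [hi]; omega)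
    simp [this]
  · have hv' : ∀ w, (∑ k, c k • theta hn k) x ![v, w] + κ ![v, w] = 0 := hv
    -- the coordinates `hi j` do not occur in the `θ_k`, so `κ` alone shows that `v (lo j) = 0`;
    -- then the projection of `v` to `ℝ³` is zero, and `κ` gives the other coordinates
    have h1 : ∀ j, v (lo j) = 0 := fun j => by
      have := hv' (Pi.single (hi j) 1)
      rw [sum_theta_apply, pr_single_of_le hn (by simp [hi]; omega), κ_apply] at this
      simpa [Pi.single_apply, hhi.eq_iff, hne] using this
    have hpr : pr hn v = 0 := by
      ext k
      exact h1 ⟨k.val, by omega⟩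
    have h2 : ∀ j, v (hi j) = 0 := fun j => by
      have := hv' (Pi.single (lo j) 1)
      rw [sum_theta_apply, hpr, κ_apply] at this
      simpa [Pi.single_apply, hlo.eq_iff, (hne _ _).symm] using this
    ext i
    by_cases hin : i.val < n
    · exact h1 ⟨i.val, hin⟩
    · have e : i = hi ⟨i.val - n, by omega⟩ := Fin.ext (by simp [hi]; omega)
      rw [e]
      exact h2 _

end Symplectic

/-! ### The case `n = 2` -/

theorem Jet.apply_zero {D : ℕ} {g : E 3 → ℝ} {c : ℕ × ℕ × ℕ → ℝ} (h : Jet D g c) (hD : 0 < D) :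
    g 0 = c (0, 0, 0) := by
  obtain ⟨H, -, hH⟩ := Hi_dil h 0
  have h0 := hH 0
  have hm : ∀ e : ℕ × ℕ × ℕ, mono e 0 = if e = (0, 0, 0) then 1 else 0 := by
    rintro ⟨i, j, k⟩
    cases i <;> cases j <;> cases k <;> simp [mono]
  rw [dil_zero, zero_pow hD.ne', zero_mul] at h0
  simp only [hm] at h0
  simp [mem_expo, wt, hD] at h0
  linarith

/-- The elements of `A0 W3` vanish at the origin, since functions vanishing on `W3` have
vanishing derivatives there. -/
theorem apply_zero_of_mem_A0 {η : Form 3 2} {hη : SmoothNearZero η} (h : germ η hη ∈ A0 W3) :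
    η 0 = 0 := by
  obtain ⟨α, hα, _, ⟨β, hβ, rfl⟩, h⟩ := Submodule.mem_sup.1 h
  obtain ⟨A, B, C, hA, hB, hC, rfl, hv⟩ := exists_form2_of_mem_LamVanish hα
  obtain ⟨p, q, r, hp, hq, hr, rfl, hw⟩ := exists_form1_of_mem_LamVanish hβ
  rw [d_germ] at h
  have e : (form2 A B C + extDeriv (form1 p q r)) =ᶠ[𝓝 0] η :=
    toGerm_eq.1 (congrArg Subtype.val h)
  rw [← e.self_of_nhds, extDeriv_form1 hp hq hr]
  obtain ⟨a0, b0, c0⟩ := hv.self_of_nhds (by simp [W3])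
  have key : ∀ f : E 3 → ℝ, ContDiff ℝ ∞ f → (∀ᶠ x in 𝓝 (0 : E 3), x ∈ W3 → f x = 0) →
      ∀ i, pd i f 0 = 0 := by
    intro f hf hfv i
    obtain ⟨c, hc⟩ := Jet.exists_of_smooth hf 14
    have V := hc.vanishing hfv
    rw [(hc.pd hf i).apply_zero (by fin_cases i <;> decide)]
    fin_cases i <;> simp [degIn, unitExp, V.x, V.y, V.z]
  have kp := key p hp (hw.mono fun x h hx => (h hx).1)
  have kq := key q hq (hw.mono fun x h hx => (h hx).2.1)
  have kr := key r hr (hw.mono fun x h hx => (h hx).2.2)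
  simp [form2, a0, b0, c0, kp, kq, kr]

/-- In dimension four a form vanishing on a hyperplane is degenerate, so the restriction to `ℝ³`
of a symplectic form does not vanish at the origin. -/
theorem coeff_ne_zero_of_symplectic (hn : 2 ≤ 2) {g : Lam (2 * 2) 2} (hg : g ∈ Symplectic (2 * 2))
    {c : Fin 9 → ℝ} (hc : g - ∑ k, c k • thetaGerm hn k ∈ A0 (W9 hn)) :
    (c 0, c 1, c 2) ≠ (0, 0, 0) := by
  intro h0
  simp only [Prod.mk.injEq] at h0
  obtain ⟨h0, h1, h2⟩ := h0
  obtain ⟨_, η, hη, rfl⟩ := g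
  have hnd : Nondeg (η 0) := (show ∀ᶠ x in 𝓝 0, Nondeg (η x) from hg.2).self_of_nhds
  have hA := pull_mem_A0 incl (fun y hy => incl_mem hn hy) hc
  rw [map_sub, map_sum] at hA
  simp only [map_smul, pull_incl_thetaGerm] at hA
  have hs : SmoothNearZero (pullForm incl η - ∑ k, c k • theta3 k) := by
    have s1 : ContDiff ℝ ∞ (∑ k, (-c k) • theta3 k) := by
      have : (∑ k, (-c k) • theta3 k) = fun x => ∑ k, (-c k) • theta3 k x := by
        ext x; simp
      rw [this]
      exact ContDiff.sum fun k _ => (theta3_contDiff k).const_smul (-c k)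
    have s2 := (SmoothNearZero.pullForm incl hη).add s1.smoothNearZero
    have e : pullForm incl η - ∑ k, c k • theta3 k = pullForm incl η + ∑ k, (-c k) • theta3 k := by
      rw [sub_eq_add_neg, ← Finset.sum_neg_distrib]
      exact congrArg _ (Finset.sum_congr rfl fun k _ => (neg_smul (c k) (theta3 k)).symm)
    rw [e]
    exact s2
  have hgerm : germ (pullForm incl η - ∑ k, c k • theta3 k) hs =
      pull incl ⟨toGerm (2 * 2) 2 η, η, hη, rfl⟩ - ∑ k, c k • theta3Germ k := by
    refine Subtype.ext ?_
    have e1 : (∑ k, c k • theta3Germ k).1 = toGerm 3 2 (∑ k, c k • theta3 k) := by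
      rw [map_sum]
      simp only [map_smul]
      rw [AddSubmonoidClass.coe_finsetSum]
      rfl
    rw [AddSubgroupClass.coe_sub, e1]
    rfl
  have hz := apply_zero_of_mem_A0 (hη := hs) ((congrArg (· ∈ A0 W3) hgerm).mpr hA)
  have hθ : (∑ k, c k • theta3 k) 0 = 0 := by
    ext v
    simp [Fin.sum_univ_succ, theta3, form2, thetaCoeff, h0, h1, h2]
  rw [Pi.sub_apply, hθ, sub_zero] at hz
  -- `ℝ³` is isotropic at `0`, so contraction with the last basis vector is injective on it
  have hiso : ∀ u u' : E 3, η 0 ![incl u, incl u'] = 0 := fun u u' => by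
    have h3 := congrArg (fun ζ => ζ ![u, u']) hz
    have e : (incl : E 3 →L[ℝ] E (2 * 2)) ∘ ![u, u'] = ![incl u, incl u'] := by
      ext i; fin_cases i <;> rfl
    simp only [pullForm, ContinuousAlternatingMap.compContinuousLinearMap_apply, map_zero, e] at h3
    exact h3
  let last : Fin (2 * 2) := 3
  have hdec : ∀ w : E (2 * 2), w = incl (pr hn w) + w last • Pi.single last 1 := by
    intro w
    ext i
    rw [Pi.add_apply]
    by_cases hi : i.val < 3
    · rw [eq_idx hn hi, incl_idx, pr_apply]
      have : idx hn ⟨i.val, hi⟩ ≠ last := fun h => by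
        have := congrArg Fin.val h
        simp [idx, last] at this
        omega
      simp [this]
    · have : i = last := Fin.ext (by simp [last]; omega)
      subst this
      rw [incl_of_le _ (not_lt.1 hi)]
      simp
  have hker : ∀ u : E 3, η 0 ![incl u, Pi.single last 1] = 0 → u = 0 := by
    intro u hu
    have : incl (n := 2) u = 0 := hnd _ fun w => by
      rw [hdec w, twoForm_add_right, twoForm_smul_right, hiso, hu, mul_zero, add_zero]
    rw [← pr_incl hn u, this, map_zero]
  let l : Fin 3 → ℝ := fun i => η 0 ![incl (Pi.single i 1), Pi.single last 1]
  -- a linear form on `ℝ³` has a nonzero kernel: `l 1 • e_0 - l 0 • e_1` is zero only if `l 0 = 0`,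
  -- and then `e_0` lies in the kernel
  have hl := hker (l 1 • Pi.single 0 1 - l 0 • Pi.single 1 1) (by
    rw [sub_eq_add_neg, ← neg_smul, map_add, map_smul, map_smul, twoForm_add_left,
      twoForm_smul_left, twoForm_smul_left]
    show l 1 * l 0 + -l 0 * l 1 = 0
    ring)
  have hl0 : l 0 = 0 := by
    have := congrFun hl 1
    simpa using this
  have h4 := congrFun (hker (Pi.single 0 1) hl0) 0
  simp at h4

/-- A `2`-form on `ℝ⁴` with nonzero Pfaffian is nondegenerate. -/
theorem nondeg_of_pfaffian {a b c a' b' c' : ℝ} {ζ : (E 4) [⋀^Fin 2]→L[ℝ] ℝ}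
    (h : ∀ v w, ζ ![v, w] = a * (v 1 * w 2 - v 2 * w 1) + b * (v 0 * w 2 - v 2 * w 0) +
      c * (v 0 * w 1 - v 1 * w 0) + a' * (v 0 * w 3 - v 3 * w 0) + b' * (v 1 * w 3 - v 3 * w 1) +
      c' * (v 2 * w 3 - v 3 * w 2)) (hne : a * a' - b * b' + c * c' ≠ 0) : Nondeg ζ := by
  intro v hv
  have e0 := hv (Pi.single 0 1)
  have e1 := hv (Pi.single 1 1)
  have e2 := hv (Pi.single 2 1)
  have e3 := hv (Pi.single 3 1)
  rw [h] at e0 e1 e2 e3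
  simp at e0 e1 e2 e3
  have key : ∀ t, (a * a' - b * b' + c * c') * t = 0 → t = 0 := fun t ht =>
    (mul_eq_zero.1 ht).resolve_left hne
  have h0 : v 0 = 0 := key _ (by linear_combination c' * e1 - b' * e2 + a * e3)
  have h1 : v 1 = 0 := key _ (by linear_combination -c' * e0 + a' * e2 - b * e3)
  have h2 : v 2 = 0 := key _ (by linear_combination b' * e0 - a' * e1 + c * e3)
  have h3 : v 3 = 0 := key _ (by linear_combination -a * e0 + b * e1 - c * e2)
  ext i
  fin_cases i
  exacts [h0, h1, h2, h3]

/-- If `(c_1, c_2, c_3) ≠ 0`, adding `(c_1 dx_1 - c_2 dx_2 + c_3 dx_3) ∧ dx_4` makes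
`∑ c_k θ_k` symplectic: the Pfaffian at the origin is `c_1² + c_2² + c_3²`. -/
theorem mem_sympRestr_of_coeff_ne_zero (hn : 2 ≤ 2) {c : Fin 9 → ℝ}
    (hc : (c 0, c 1, c 2) ≠ (0, 0, 0)) :
    restr (W9 hn) (∑ k, c k • thetaGerm hn k) ∈ sympRestr (W9 hn) := by
  let κ : (E (2 * 2)) [⋀^Fin 2]→L[ℝ] ℝ :=
    c 0 • dxdx 0 3 + (-c 1) • dxdx 1 3 + c 2 • dxdx 2 3
  have κ_apply : ∀ v w, κ ![v, w] = c 0 * (v 0 * w 3 - v 3 * w 0) +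
      -c 1 * (v 1 * w 3 - v 3 * w 1) + c 2 * (v 2 * w 3 - v 3 * w 2) := fun v w => rfl
  refine mem_sympRestr_of_nondeg hn c κ ?_ ?_
  · ext v
    rw [ContinuousAlternatingMap.compContinuousLinearMap_apply, ← pair_eta (incl ∘ v), κ_apply]
    have : ∀ y : E 3, incl (n := 2) y 3 = 0 := fun y => incl_of_le y (le_refl 3)
    simp [this]
  · let P : E (2 * 2) → ℝ := fun x => (∑ k, c k * thetaCoeff k 0 (pr hn x)) * c 0 -
      (∑ k, c k * thetaCoeff k 1 (pr hn x)) * -c 1 + (∑ k, c k * thetaCoeff k 2 (pr hn x)) * c 2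
    have hP : Continuous P := by
      have : ∀ i, Continuous fun x => ∑ k, c k * thetaCoeff k i (pr hn x) := fun i =>
        continuous_finsetSum _ fun k _ => continuous_const.mul
          ((thetaCoeff_smooth k i).continuous.comp (pr hn).continuous)
      exact (((this 0).mul_const _).sub ((this 1).mul_const _)).add ((this 2).mul_const _)
    have hP0 : P 0 ≠ 0 := by
      have e : P 0 = c 0 ^ 2 + c 1 ^ 2 + c 2 ^ 2 := by
        simp [P, Fin.sum_univ_succ, thetaCoeff]
        ring
      rw [e]
      intro h
      apply hc
      simp only [Prod.mk.injEq]
      refine ⟨?_, ?_, ?_⟩ <;> nlinarith [sq_nonneg (c 0), sq_nonneg (c 1), sq_nonneg (c 2)]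
    filter_upwards [hP.continuousAt.eventually_ne hP0] with x hx
    refine nondeg_of_pfaffian (fun v w => ?_) hx
    rw [ContinuousAlternatingMap.add_apply, sum_theta_apply, κ_apply]
    simp only [pr_apply]
    show _ * (v 1 * w 2 - v 2 * w 1) + _ * (v 0 * w 2 - v 2 * w 0) +
      _ * (v 0 * w 1 - v 1 * w 0) + _ = _
    ring

/-! ### The basis of restrictions -/

section Basis

variable {n : ℕ} (hn : 2 ≤ n)

theorem restr_eq_iff {g g' : Lam (2 * n) 2} :
    restr (W9 hn) g = restr (W9 hn) g' ↔ g - g' ∈ A0 (W9 hn) :=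
  Submodule.Quotient.eq _

theorem restr_sum_injective {c c' : Fin 9 → ℝ}
    (h : restr (W9 hn) (∑ k, c k • thetaGerm hn k) =
      restr (W9 hn) (∑ k, c' k • thetaGerm hn k)) : c = c' := by
  rw [restr_eq_iff, ← Finset.sum_sub_distrib] at h
  simp only [← sub_smul] at h
  exact sub_eq_zero.1 (theta_independent hn (c := c - c') h)

theorem exists_basis : ∃ b : Module.Basis (Fin 9) ℝ (closedRestr (W9 hn)), ∀ k : Fin 9,
    (b k : Restr (W9 hn)) = restr (W9 hn) (thetaGerm hn k) := by
  let v : Fin 9 → closedRestr (W9 hn) := fun k =>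
    ⟨restr (W9 hn) (thetaGerm hn k), Submodule.mem_map_of_mem (thetaGerm_mem_Closed hn k)⟩
  have hsum : ∀ c : Fin 9 → ℝ, ((∑ k, c k • v k : closedRestr (W9 hn)) : Restr (W9 hn)) =
      restr (W9 hn) (∑ k, c k • thetaGerm hn k) := fun c => by
    rw [map_sum, AddSubmonoidClass.coe_finsetSum]
    simp only [map_smul]
    rfl
  have hli : LinearIndependent ℝ v := by
    refine Fintype.linearIndependent_iff.2 fun c hc => congrFun (theta_independent hn ?_)
    have h1 := congrArg Subtype.val hc
    rw [hsum] at h1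
    exact (Submodule.Quotient.mk_eq_zero _).1 h1
  have hsp : ⊤ ≤ Submodule.span ℝ (Set.range v) := by
    rintro ⟨_, g, hg, rfl⟩ -
    obtain ⟨c, hc⟩ := exists_theta_combination hn hg
    refine (Submodule.mem_span_range_iff_exists_fun ℝ).2 ⟨c, Subtype.ext ?_⟩
    rw [hsum]
    exact ((restr_eq_iff hn).2 hc).symm
  exact ⟨Module.Basis.mk hli hsp, fun k => by rw [Module.Basis.mk_apply]⟩

theorem sympRestr_eq_closedRestr (h3 : 3 ≤ n) :
    sympRestr (W9 hn) = (closedRestr (W9 hn) : Set (Restr (W9 hn))) := by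
  refine Set.Subset.antisymm ?_ ?_
  · rintro _ ⟨g, hg, rfl⟩
    exact Submodule.mem_map_of_mem hg.1
  · rintro _ ⟨g, hg, rfl⟩
    obtain ⟨c, hc⟩ := exists_theta_combination hn hg
    rw [(restr_eq_iff hn).2 hc]
    exact mem_sympRestr_of_three_le hn h3 c

end Basis

theorem sympRestr_eq_of_two (hn : 2 ≤ 2) : sympRestr (W9 hn) =
    {a | ∃ c : Fin 9 → ℝ, (c 0, c 1, c 2) ≠ (0, 0, 0) ∧
      a = restr (W9 hn) (∑ k, c k • thetaGerm hn k)} := by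
  refine Set.Subset.antisymm ?_ ?_
  · rintro _ ⟨g, hg, rfl⟩
    obtain ⟨c, hc⟩ := exists_theta_combination hn hg.1
    exact ⟨c, coeff_ne_zero_of_symplectic hn hg hc, (restr_eq_iff hn).2 hc⟩
  · rintro _ ⟨c, hc, rfl⟩
    exact mem_sympRestr_of_coeff_ne_zero hn hc

theorem isOpen_symplectic_coeff (hn : 2 ≤ 2) : IsOpen {c : Fin 9 → ℝ |
    restr (W9 hn) (∑ k, c k • thetaGerm hn k) ∈ sympRestr (W9 hn)} := by
  have e : {c : Fin 9 → ℝ | restr (W9 hn) (∑ k, c k • thetaGerm hn k) ∈ sympRestr (W9 hn)} =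
      {c | (c 0, c 1, c 2) ≠ (0, 0, 0)} := by
    ext c
    rw [Set.mem_ofPred_eq, sympRestr_eq_of_two, Set.mem_ofPred_eq]
    refine ⟨?_, fun h => ⟨c, h, rfl⟩⟩
    rintro ⟨c', hc', h⟩
    rwa [restr_sum_injective hn h]
  rw [e]
  exact isOpen_ne_fun (by fun_prop) continuous_const

end AlgRestr

end

theorem mainTheorem6 (n : ℕ) (hn : 2 ≤ n) :
    -- each `θ_i` is quasi-homogeneous of degree `δ_i` for all weights extending `(5, 4, 3)`
    (∀ w : Fin (2 * n) → ℝ, (∀ i, 0 < w i) →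
      w (AlgRestr.idx hn 0) = 5 → w (AlgRestr.idx hn 1) = 4 → w (AlgRestr.idx hn 2) = 3 →
      ∀ k : Fin 9, AlgRestr.IsQuasiHomogeneous w (AlgRestr.delta k) (AlgRestr.theta hn k)) ∧
    -- each `θ_i` is closed
    (∀ k : Fin 9, AlgRestr.thetaGerm hn k ∈ AlgRestr.Closed (2 * n)) ∧
    -- the space of algebraic restrictions of closed 2-forms has dimension 9 ...
    Module.finrank ℝ (AlgRestr.closedRestr (AlgRestr.W9 hn)) = 9 ∧
    -- ... with basis `[θ_1], …, [θ_9]`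
    (∃ b : Module.Basis (Fin 9) ℝ (AlgRestr.closedRestr (AlgRestr.W9 hn)), ∀ k : Fin 9,
      (b k : AlgRestr.Restr (AlgRestr.W9 hn)) =
        AlgRestr.restr (AlgRestr.W9 hn) (AlgRestr.thetaGerm hn k)) ∧
    -- every such restriction comes from a symplectic form if `n ≥ 3`
    (3 ≤ n → AlgRestr.sympRestr (AlgRestr.W9 hn) =
      (AlgRestr.closedRestr (AlgRestr.W9 hn) : Set (AlgRestr.Restr (AlgRestr.W9 hn)))) ∧
    -- for `n = 2`, those with `(c_1, c_2, c_3) ≠ 0` do, and they form an open part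
    (n = 2 →
      AlgRestr.sympRestr (AlgRestr.W9 hn) =
        {a | ∃ c : Fin 9 → ℝ, (c 0, c 1, c 2) ≠ (0, 0, 0) ∧
          a = AlgRestr.restr (AlgRestr.W9 hn) (∑ k, c k • AlgRestr.thetaGerm hn k)} ∧
      IsOpen {c : Fin 9 → ℝ |
        AlgRestr.restr (AlgRestr.W9 hn) (∑ k, c k • AlgRestr.thetaGerm hn k) ∈
          AlgRestr.sympRestr (AlgRestr.W9 hn)}) := by
  refine ⟨fun w _ h0 h1 h2 k => AlgRestr.theta_isQuasiHomogeneous hn h0 h1 h2 k,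
    AlgRestr.thetaGerm_mem_Closed hn, ?_, AlgRestr.exists_basis hn,
    AlgRestr.sympRestr_eq_closedRestr hn, ?_⟩
  · obtain ⟨b, -⟩ := AlgRestr.exists_basis hn
    rw [Module.finrank_eq_card_basis b, Fintype.card_fin]
  · rintro rfl
    exact ⟨AlgRestr.sympRestr_eq_of_two hn, AlgRestr.isOpen_symplectic_coeff hn⟩
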